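/- Let $1\le d$ and let $X\in\mathbb{R}^{d\times k}$ have full rank $d$; let $\sigma\ge 0$ be known and $\delta\in(0,1)$. Observations follow the model $Y=QX+\sigma E$, where $Q$ is a random orthogonal matrix in $O(d)$ (with any law, e.g. uniform) and $E\in\mathbb{R}^{d\times k}$ has i.i.d. standard Gaussian entries and is independent of $Q$. Write $[X]=\{QX: Q\in O(d)\}$, $\rho([X],[X'])=\min_{Q\in O(d)}\|X-QX'\|_{\mathrm F}$, let $\|X\|_{\mathrm{op}}$ be the operator norm and $\sigma_d(X)$ the $d$-th largest singular value of $X$. Given i.i.d. samples $Y_1,\dots,Y_N$ ($N\ge 1$) of the model, let $\hat G_N=\frac1N\sum_{i=1}^N Y_i^TY_i-d\sigma^2I_k$, let $\lambda_1\ge\dots\ge\lambda_k$ be its eigenvalues with an orthonormal basis of eigenvectors $v_1,\dots,v_k$ (any choice is allowed), and let the estimator be $[\tilde X]$, where $\tilde X\in\mathbb{R}^{d\times k}$ has rows $\sqrt{\max(\lambda_i,0)}\,v_i^T$, $i=1,\dots,d$. Consider, for a constant $L>0$, the bound $$\rho([X],[\tilde X])\le \frac{8L\sqrt{2d}}{\sigma_d(X)}\left[\sqrt{\left(2\|X\|_{\mathrm{op}}^2+d\sigma^2\right)\frac{\sigma^2}{N}k\log\left(\frac{10}{\delta}\right)}+\frac{\sigma^2}{N}k\log\left(\frac{10}{\delta}\right)\right].\qquad(*)$$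 1. For every $N\ge1$, with probability at least $1-\delta$, $(*)$ holds with $L=1/\sqrt{2(\sqrt2-1)}$. 2. For every $L>1/\sqrt2$ there is $N_0$, depending only on $d,k,X,\sigma,\delta,L$, such that for all $N\ge\max(N_0,1)$, with probability at least $1-\delta$, $(*)$ holds with this $L$. In both parts, "with probability at least $1-\delta$" means that there is a measurable event of probability at least $1-\delta$ on which $(*)$ holds for every choice of the eigenvectors. -/

import Mathlib

open MeasureTheory ProbabilityTheory
open scoped Matrix

noncomputable section

namespace CloudEstimation

/-! ### Clouds of `k` labelled points in `ℝ^d`, up to orthogonal transformations -/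

/-- Two clouds are equivalent when they differ by an orthogonal transformation. -/
def cloudSetoid (d k : ℕ) : Setoid (Matrix (Fin d) (Fin k) ℝ) where
  r X Y := ∃ Q : Matrix.orthogonalGroup (Fin d) ℝ, Y = (Q : Matrix (Fin d) (Fin d) ℝ) * X
  iseqv :=
    { refl := fun X => ⟨1, by simp⟩
      symm := by
        rintro X Y ⟨Q, rfl⟩
        exact ⟨Q⁻¹, by
          rw [← Matrix.mul_assoc, ← Matrix.UnitaryGroup.mul_val, inv_mul_cancel]; simp⟩
      trans := by
        rintro X Y Z ⟨Q, rfl⟩ ⟨R, rfl⟩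
        exact ⟨R * Q, by rw [Matrix.UnitaryGroup.mul_val, Matrix.mul_assoc]⟩ }

/-- The space of equivalence classes `[X]`. -/
def CloudClass (d k : ℕ) : Type := Quotient (cloudSetoid d k)

/-- The equivalence class `[X]`. -/
def cloudClass {d k : ℕ} (X : Matrix (Fin d) (Fin k) ℝ) : CloudClass d k :=
  Quotient.mk (cloudSetoid d k) X

section
open scoped Matrix.Norms.Frobenius

/-- The Frobenius norm. -/
def frobNorm {m n : ℕ} (A : Matrix (Fin m) (Fin n) ℝ) : ℝ := ‖A‖

end

theorem frobNorm_eq {m n : ℕ} (A : Matrix (Fin m) (Fin n) ℝ) :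
    frobNorm A = √(∑ i, ∑ j, A i j ^ 2) := by
  simp [frobNorm, Matrix.frobenius_norm_def, Real.sqrt_eq_rpow]

theorem frobNorm_orthogonal_mul {m n : ℕ} (Q : Matrix.orthogonalGroup (Fin m) ℝ)
    (A : Matrix (Fin m) (Fin n) ℝ) :
    frobNorm ((Q : Matrix (Fin m) (Fin m) ℝ) * A) = frobNorm A := by
  have key : ∀ B : Matrix (Fin m) (Fin n) ℝ,
      ∑ i, ∑ j, B i j ^ 2 = Matrix.trace (Bᵀ * B) := by
    intro B
    simp only [Matrix.trace, Matrix.diag, Matrix.mul_apply, Matrix.transpose_apply, ← sq]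
    exact Finset.sum_comm
  have hQ : (Q : Matrix (Fin m) (Fin m) ℝ)ᵀ * (Q : Matrix (Fin m) (Fin m) ℝ) = 1 := by
    simpa [Matrix.star_eq_conjTranspose] using Matrix.UnitaryGroup.star_mul_self Q
  rw [frobNorm_eq, frobNorm_eq, key, key, Matrix.transpose_mul, Matrix.mul_assoc,
    ← Matrix.mul_assoc _ _ A, hQ, Matrix.one_mul]

/-- The distance `min_{Q ∈ O(d)} ‖X - Q Y‖_F` between two representatives. -/
def alignDist {d k : ℕ} (X Y : Matrix (Fin d) (Fin k) ℝ) : ℝ :=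
  ⨅ Q : Matrix.orthogonalGroup (Fin d) ℝ, frobNorm (X - (Q : Matrix (Fin d) (Fin d) ℝ) * Y)

theorem alignDist_congr {d k : ℕ} (X Y X' Y' : Matrix (Fin d) (Fin k) ℝ)
    (hX : (cloudSetoid d k).r X X') (hY : (cloudSetoid d k).r Y Y') :
    alignDist X Y = alignDist X' Y' := by
  obtain ⟨P, rfl⟩ := hX
  obtain ⟨R, rfl⟩ := hY
  unfold alignDist
  refine (Equiv.iInf_congr ((Equiv.mulLeft P).trans (Equiv.mulRight R⁻¹)) ?_)
  intro Q
  have h : (P : Matrix (Fin d) (Fin d) ℝ) * X -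
      ((P * Q * R⁻¹ : Matrix.orthogonalGroup (Fin d) ℝ) : Matrix (Fin d) (Fin d) ℝ) *
        ((R : Matrix (Fin d) (Fin d) ℝ) * Y) =
      (P : Matrix (Fin d) (Fin d) ℝ) * (X - (Q : Matrix (Fin d) (Fin d) ℝ) * Y) := by
    rw [← Matrix.mul_assoc, ← Matrix.UnitaryGroup.mul_val, inv_mul_cancel_right,
      Matrix.UnitaryGroup.mul_val, Matrix.mul_assoc, Matrix.mul_sub]
  change frobNorm (_ - ((P * Q * R⁻¹ : Matrix.orthogonalGroup (Fin d) ℝ) :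
    Matrix (Fin d) (Fin d) ℝ) * _) = _
  rw [h, frobNorm_orthogonal_mul]

/-- The distance `ρ([X], [Y]) = min_{Q ∈ O(d)} ‖X - Q Y‖_F` between equivalence classes. -/
def rho {d k : ℕ} (x y : CloudClass d k) : ℝ :=
  Quotient.lift₂ (s₁ := cloudSetoid d k) (s₂ := cloudSetoid d k) alignDist alignDist_congr x y

/-! ### Singular values -/

/-- The operator norm (largest singular value) of a matrix. -/
def opNorm {m n : ℕ} (A : Matrix (Fin m) (Fin n) ℝ) : ℝ :=
  ‖(Matrix.toEuclideanLin A).toContinuousLinearMap‖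

/-- The `i`-th largest singular value `σ_i(A)`, for `i ≥ 1`
(`LinearMap.singularValues` counts from zero). -/
def singularValue {m n : ℕ} (A : Matrix (Fin m) (Fin n) ℝ) (i : ℕ) : ℝ :=
  (Matrix.toEuclideanLin A).singularValues (i - 1)

/-! ### The observation model -/

/-- Matrices carry the product (equivalently, Borel) sigma-algebra of their entries. -/
instance matrixMeasurableSpace (m n : ℕ) : MeasurableSpace (Matrix (Fin m) (Fin n) ℝ) :=
  inferInstanceAs (MeasurableSpace (Fin m → Fin n → ℝ))

/-- The law of a matrix with independent standard Gaussian entries. -/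
def gaussianMatrix (m n : ℕ) : Measure (Matrix (Fin m) (Fin n) ℝ) :=
  (Measure.pi fun _ : Fin m => Measure.pi fun _ : Fin n => gaussianReal 0 1 :
    Measure (Fin m → Fin n → ℝ))

instance (m n : ℕ) : IsProbabilityMeasure (gaussianMatrix m n) :=
  inferInstanceAs (IsProbabilityMeasure
    (Measure.pi fun _ : Fin m => Measure.pi fun _ : Fin n => gaussianReal 0 1))

/-- The law of one observation `Y = Q X + σ E`: `Q` is a random orthogonal matrix with law `ν`,
and `E` has independent standard Gaussian entries and is independent of `Q`. -/
def observationLaw {d k : ℕ} (ν : Measure (Matrix.orthogonalGroup (Fin d) ℝ))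
    (X : Matrix (Fin d) (Fin k) ℝ) (σ : ℝ) : Measure (Matrix (Fin d) (Fin k) ℝ) :=
  (ν.prod (gaussianMatrix d k)).map
    fun p => (p.1 : Matrix (Fin d) (Fin d) ℝ) * X + σ • p.2

theorem measurable_observation {d k : ℕ} (X : Matrix (Fin d) (Fin k) ℝ) (σ : ℝ) :
    Measurable fun p : Matrix.orthogonalGroup (Fin d) ℝ × Matrix (Fin d) (Fin k) ℝ =>
      (p.1 : Matrix (Fin d) (Fin d) ℝ) * X + σ • p.2 := by
  refine measurable_pi_lambda _ fun i => measurable_pi_lambda _ fun j => ?_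
  simp only [Matrix.add_apply, Matrix.mul_apply, Matrix.smul_apply, smul_eq_mul]
  have h1 : ∀ l, Measurable fun p : Matrix.orthogonalGroup (Fin d) ℝ × Matrix (Fin d) (Fin k) ℝ =>
      (p.1 : Matrix (Fin d) (Fin d) ℝ) i l := fun l =>
    (measurable_pi_apply l).comp ((measurable_pi_apply i).comp
      (measurable_subtype_coe.comp measurable_fst))
  have h2 : Measurable fun p : Matrix.orthogonalGroup (Fin d) ℝ × Matrix (Fin d) (Fin k) ℝ =>
      p.2 i j :=
    (measurable_pi_apply j).comp ((measurable_pi_apply i).comp measurable_snd)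
  exact (Finset.measurable_sum _ fun l _ => (h1 l).mul_const _).add (h2.const_mul _)

instance {d k : ℕ} (ν : Measure (Matrix.orthogonalGroup (Fin d) ℝ)) [IsProbabilityMeasure ν]
    (X : Matrix (Fin d) (Fin k) ℝ) (σ : ℝ) : IsProbabilityMeasure (observationLaw ν X σ) :=
  Measure.isProbabilityMeasure_map (measurable_observation X σ).aemeasurable

/-- `Y_1, …, Y_N` are i.i.d. observations drawn from the model `Y = Q X + σ E`. -/
structure IsIIDSample {d k N : ℕ} {Ω : Type*} [MeasurableSpace Ω] (μ : Measure Ω)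
    (ν : Measure (Matrix.orthogonalGroup (Fin d) ℝ)) (X : Matrix (Fin d) (Fin k) ℝ) (σ : ℝ)
    (Y : Fin N → Ω → Matrix (Fin d) (Fin k) ℝ) : Prop where
  law : ∀ i, HasLaw (Y i) (observationLaw ν X σ) μ
  indep : iIndepFun Y μ

/-! ### The estimator -/

/-- The Gram matrix estimator `(1/N) ∑ Y_iᵀ Y_i - d σ² I_k`. -/
def gramEstimator {d k N : ℕ} (σ : ℝ) (Y : Fin N → Matrix (Fin d) (Fin k) ℝ) :
    Matrix (Fin k) (Fin k) ℝ :=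
  (1 / (N : ℝ)) • ∑ i, (Y i)ᵀ * Y i - ((d : ℝ) * σ ^ 2) • (1 : Matrix (Fin k) (Fin k) ℝ)

/-- The `d × k` matrix with rows `α_i v_iᵀ`, `α_i = √(max(λ_i, 0))`, `1 ≤ i ≤ d`
(zero rows are appended if `d > k`). -/
def gramFactor {k : ℕ} (d : ℕ) (eig : Fin k → ℝ) (v : Fin k → EuclideanSpace ℝ (Fin k)) :
    Matrix (Fin d) (Fin k) ℝ :=
  Matrix.of fun i j => if h : (i : ℕ) < k then √(max (eig ⟨i, h⟩) 0) * v ⟨i, h⟩ j else 0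

/-- `x` is a possible output of the algorithm on input `Y_1, …, Y_N`: form the Gram estimator,
take an orthonormal basis of eigenvectors with the eigenvalues in decreasing order,
and return the class of the matrix with rows `α_i v_iᵀ`, `α_i = √(max(λ_i, 0))`, `1 ≤ i ≤ d`.
The eigenbasis, hence possibly the output, need not be unique if eigenvalues coincide. -/
def IsAlgorithmOutput {d k N : ℕ} (σ : ℝ) (Y : Fin N → Matrix (Fin d) (Fin k) ℝ)
    (x : CloudClass d k) : Prop :=
  ∃ (eig : Fin k → ℝ) (v : OrthonormalBasis (Fin k) ℝ (EuclideanSpace ℝ (Fin k))),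
    Antitone eig ∧
    (∀ j, Matrix.toEuclideanLin (gramEstimator σ Y) (v j) = eig j • v j) ∧
    x = cloudClass (gramFactor d eig v)

/-- The algorithm always has an output. -/
theorem exists_isAlgorithmOutput {d k N : ℕ} (σ : ℝ) (Y : Fin N → Matrix (Fin d) (Fin k) ℝ) :
    ∃ x, IsAlgorithmOutput σ Y x := by
  have hH : (gramEstimator σ Y).IsHermitian := by
    rw [Matrix.IsHermitian, Matrix.conjTranspose_eq_transpose_of_trivial]
    simp [gramEstimator, Matrix.transpose_sum, Matrix.transpose_mul]
  have hS := Matrix.isSymmetric_toEuclideanLin_iff.mpr hH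
  exact ⟨_, hS.eigenvalues finrank_euclideanSpace_fin, hS.eigenvectorBasis
    finrank_euclideanSpace_fin, hS.eigenvalues_antitone _,
    fun j => by simp, rfl⟩

/-- The right-hand side
`(8 L √(2d) / σ_d(X)) [√((2‖X‖² + dσ²) (σ²/N) k log(10/δ)) + (σ²/N) k log(10/δ)]`. -/
def errorBound {d k : ℕ} (L : ℝ) (X : Matrix (Fin d) (Fin k) ℝ) (σ δ : ℝ) (N : ℕ) : ℝ :=
  8 * L * √(2 * d) / singularValue X d *
    (√((2 * opNorm X ^ 2 + d * σ ^ 2) * (σ ^ 2 / N) * k * Real.log (10 / δ)) +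
      σ ^ 2 / N * k * Real.log (10 / δ))

end CloudEstimation

end

/-!
The bound combines a deterministic perturbation estimate with a uniform concentration inequality.

*Perturbation.* Put `G = Xᵀ X`, let `H` be the Gram estimator and `V` the matrix of the output.
If the quadratic form of `H - G` is at most `t ‖u‖²` in absolute value, then all eigenvalues of
`H` are at least `-t` and all but the first `d` are at most `t` (`neg_le_eigenvalue`,
`eigenvalue_le_of_le`), so `Vᵀ V` is within `t` of `H` and within `2t` of `G`. As `Vᵀ V - G` has rank at most `2d`, its
Frobenius norm is at most `2t √(2d)` (`frobNorm_gramFactor_sub_le`). To return from Gram matrices to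
clouds, `V` is rotated to a matrix `U` with `X Uᵀ` positive semidefinite, by polar decomposition.
For such aligned pairs, `‖U - X‖` is at most `‖Uᵀ U - G‖ / (σ_d(X) √(2 (√2 - 1)))`
(`frobNorm_gram_sub_sq_ge`). Moreover the linear part of `Uᵀ U - G` in `Δ = U - X` has norm at
least `√2 σ_d(X) ‖Δ‖` (`frobNorm_gram_sub_ge`), which improves the constant to any `L > 1 / √2` once
`Δ` is small; the first bound together with `N → ∞` guarantees smallness.

*Concentration.* For a unit vector `u`, `‖Y u‖²` is a noncentral chi-squared variable whose law does
not involve the random rotation, because `‖Q X u‖ = ‖X u‖`. Its centred exponential moments are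
sub-gamma (`mgf_norm_sq_observationLaw_le`), so the mean over the sample deviates by more than twice
`√(V x / N) + σ² x / N`, with `V = σ² (2 ‖X‖² + d σ²)`, with probability at most `2 exp (-x)`.
With `x = k log (10 / δ)` this is `2 (δ / 10) ^ k`. A net of directions modulo sign with at most
`9 ^ k / 2` points (`exists_symmetric_net`) has total failure probability at most
`(9 δ / 10) ^ k ≤ δ`, and passing from the net to all directions costs a factor `2`.
Identifying antipodal points is what makes the count fit the constant `10` for every `δ < 1`.
-/

namespace CloudEstimation

/-! ### Optimal alignment by polar decomposition -/

/-- The map `f x ↦ g x` is a well-defined isometry on the range of `f`; it extends to the whole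
space by finite dimensionality. -/
theorem exists_linearIsometry_comp_eq {E : Type*} [NormedAddCommGroup E] [InnerProductSpace ℝ E]
    [FiniteDimensional ℝ E] (f g : E →ₗ[ℝ] E) (h : ∀ x, ‖f x‖ = ‖g x‖) :
    ∃ e : E →ₗᵢ[ℝ] E, ∀ x, e (f x) = g x := by
  have hker : f.ker ≤ g.ker := fun x hx => by
    rw [LinearMap.mem_ker] at hx ⊢
    rw [← norm_eq_zero, ← h, hx, norm_zero]
  let l : f.range →ₗ[ℝ] E := (f.ker.liftQ g hker) ∘ₗ f.quotKerEquivRange.symm.toLinearMap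
  have hl : ∀ x (hx : f x ∈ f.range), l ⟨f x, hx⟩ = g x := fun x hx => by
    simp [l, LinearMap.quotKerEquivRange_symm_apply_image]
  let e : f.range →ₗᵢ[ℝ] E := ⟨l, by
    rintro ⟨y, hy⟩
    obtain ⟨x, rfl⟩ := hy
    exact (congrArg norm (hl x _)).trans (h x).symm⟩
  refine ⟨e.extend, fun x => ?_⟩
  have := LinearIsometry.extend_apply e ⟨f x, x, rfl⟩
  exact this.trans (hl x _)

theorem norm_toEuclideanLin_sq {m n : ℕ} (A : Matrix (Fin m) (Fin n) ℝ)
    (x : EuclideanSpace ℝ (Fin n)) :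
    ‖Matrix.toEuclideanLin A x‖ ^ 2 = x.ofLp ⬝ᵥ (Aᵀ * A) *ᵥ x.ofLp := by
  rw [← real_inner_self_eq_norm_sq, EuclideanSpace.inner_eq_star_dotProduct]
  simp [Matrix.toLpLin_apply, ← Matrix.mulVec_mulVec, Matrix.dotProduct_mulVec,
    Matrix.vecMul_transpose]

open scoped MatrixOrder Matrix.Norms.L2Operator in
/-- Right polar decomposition: a real square matrix becomes positive semidefinite after
multiplication by a suitable orthogonal matrix. -/
theorem exists_mul_orthogonal_posSemidef {n : ℕ} (M : Matrix (Fin n) (Fin n) ℝ) :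
    ∃ R : Matrix.orthogonalGroup (Fin n) ℝ,
      (M * (R : Matrix (Fin n) (Fin n) ℝ)).PosSemidef := by
  set S := CFC.sqrt (M * Mᵀ) with hS
  have hpsd : (M * Mᵀ).PosSemidef := by
    simpa using Matrix.posSemidef_self_mul_conjTranspose M
  have hSS : S * S = M * Mᵀ := CFC.sqrt_mul_sqrt_self _ hpsd.nonneg
  have hSpos : S.PosSemidef := Matrix.nonneg_iff_posSemidef.mp (CFC.sqrt_nonneg _)
  have hST : Sᵀ = S := by simpa using hSpos.isHermitian.eq
  obtain ⟨e, he⟩ := exists_linearIsometry_comp_eq (Matrix.toEuclideanLin Mᵀ)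
    (Matrix.toEuclideanLin S) fun x => by
      rw [← sq_eq_sq₀ (norm_nonneg _) (norm_nonneg _), norm_toEuclideanLin_sq,
        norm_toEuclideanLin_sq, hST, hSS, Matrix.transpose_transpose]
  set T := Matrix.toEuclideanLin.symm e.toLinearMap with hT
  have hTe : Matrix.toEuclideanLin T = e.toLinearMap := by simp [hT]
  have hTM : T * Mᵀ = S := by
    apply Matrix.toEuclideanLin.injective
    ext1 x
    rw [← he x]
    have : e (Matrix.toEuclideanLin Mᵀ x) =
        Matrix.toEuclideanLin T (Matrix.toEuclideanLin Mᵀ x) := by rw [hTe]; rfl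
    rw [this]
    simp [Matrix.toLpLin_apply, Matrix.mulVec_mulVec]
  have hTT : Tᵀ * T = 1 := by
    apply Matrix.toEuclideanLin.injective
    ext1 x
    refine ext_inner_left ℝ fun y => ?_
    have h1 := e.inner_map_map y x
    have h2 : ∀ z, e z = Matrix.toEuclideanLin T z := fun z => by rw [hTe]; rfl
    rw [h2, h2] at h1
    rw [EuclideanSpace.inner_eq_star_dotProduct] at h1 ⊢
    rw [EuclideanSpace.inner_eq_star_dotProduct] at h1 ⊢
    simp only [Matrix.toLpLin_apply, star_trivial, ← Matrix.mulVec_mulVec, Matrix.one_mulVec]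
      at h1 ⊢
    rw [← h1, dotProduct_comm, Matrix.dotProduct_mulVec, Matrix.vecMul_transpose, dotProduct_comm]
  refine ⟨⟨Tᵀ, ?_⟩, ?_⟩
  · rw [Matrix.mem_orthogonalGroup_iff]
    simpa [Matrix.star_eq_conjTranspose] using hTT
  · have : M * Tᵀ = S := by rw [← hST, ← hTM, Matrix.transpose_mul, Matrix.transpose_transpose]
    change (M * Tᵀ).PosSemidef
    rwa [this]

/-! ### Procrustes bounds for the alignment distance -/

theorem frobNorm_sq {m n : ℕ} (A : Matrix (Fin m) (Fin n) ℝ) :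
    frobNorm A ^ 2 = (A * Aᵀ).trace := by
  rw [frobNorm_eq, Real.sq_sqrt (by positivity)]
  simp [Matrix.trace, Matrix.mul_apply, sq]

theorem frobNorm_nonneg {m n : ℕ} (A : Matrix (Fin m) (Fin n) ℝ) : 0 ≤ frobNorm A := by
  rw [frobNorm_eq]; positivity

theorem frobNorm_neg {m n : ℕ} (A : Matrix (Fin m) (Fin n) ℝ) : frobNorm (-A) = frobNorm A := by
  simp [frobNorm_eq]

open scoped Matrix.Norms.Frobenius in
theorem frobNorm_add_le {m n : ℕ} (A B : Matrix (Fin m) (Fin n) ℝ) :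
    frobNorm (A + B) ≤ frobNorm A + frobNorm B := norm_add_le A B

open scoped Matrix.Norms.Frobenius in
theorem frobNorm_transpose_mul_self_le {m n : ℕ} (A : Matrix (Fin m) (Fin n) ℝ) :
    frobNorm (Aᵀ * A) ≤ frobNorm A ^ 2 := by
  have h : ‖Aᵀ‖ = ‖A‖ := Matrix.frobenius_norm_transpose A
  have := Matrix.frobenius_norm_mul Aᵀ A
  rw [h, ← sq] at this
  exact this

theorem trace_mul_nonneg_of_posSemidef {n : ℕ} {B : Matrix (Fin n) (Fin n) ℝ}
    (hB : B.PosSemidef) {m : ℕ} (A : Matrix (Fin n) (Fin m) ℝ) :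
    0 ≤ (A * Aᵀ * B).trace := by
  have := (hB.conjTranspose_mul_mul_same A).trace_nonneg
  rwa [Matrix.trace_mul_comm, Matrix.conjTranspose_eq_transpose_of_trivial, ← Matrix.mul_assoc]
    at this

theorem trace_mul_self_nonneg {n : ℕ} {A : Matrix (Fin n) (Fin n) ℝ} (hA : Aᵀ = A) :
    0 ≤ (A * A).trace := by
  nth_rewrite 2 [← hA]
  rw [← frobNorm_sq]
  positivity

theorem trace_mul_mul_mul_cycle {d k : ℕ} (A B C D : Matrix (Fin d) (Fin k) ℝ) :
    (Aᵀ * B * (Cᵀ * D)).trace = (B * Cᵀ * (D * Aᵀ)).trace := by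
  rw [Matrix.mul_assoc, Matrix.trace_mul_comm]
  simp only [Matrix.mul_assoc]

/-- Distance of aligned representatives in terms of their Gram matrices. With `A = Δ Δᵀ`,
`B = Δ Xᵀ` (symmetric by alignment) and `C = X Xᵀ`, the right-hand side is
`tr (A + √2 B)² + (4 - 2√2) tr A (B + C) + 2 (√2 - 1) tr A C`, where `B + C = U Xᵀ` is positive
semidefinite; completing the square with `√2` yields the constant. -/
theorem frobNorm_gram_sub_sq_ge {d k : ℕ} {X U : Matrix (Fin d) (Fin k) ℝ} {s : ℝ}
    (hs : (X * Xᵀ - s ^ 2 • (1 : Matrix (Fin d) (Fin d) ℝ)).PosSemidef)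
    (hU : (X * Uᵀ).PosSemidef) :
    2 * (√2 - 1) * s ^ 2 * frobNorm (U - X) ^ 2 ≤ frobNorm (Uᵀ * U - Xᵀ * X) ^ 2 := by
  have hsym : U * Xᵀ = X * Uᵀ := by
    simpa using hU.isHermitian.eq
  set Δ := U - X with hΔ
  have hUe : U = X + Δ := by simp [hΔ]
  have hB : Δ * Xᵀ = X * Δᵀ := by
    simp only [hΔ, Matrix.sub_mul, Matrix.mul_sub, Matrix.transpose_sub, hsym]
  set A := Δ * Δᵀ with hA
  set B := Δ * Xᵀ with hBdef
  set C := X * Xᵀ with hC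
  have hAT : Aᵀ = A := by simp [hA]
  have hBT : Bᵀ = B := by rw [hBdef, Matrix.transpose_mul, Matrix.transpose_transpose, ← hB]
  have key : frobNorm (Uᵀ * U - Xᵀ * X) ^ 2 =
      (A * A).trace + 4 * (A * B).trace + 2 * (B * B).trace + 2 * (A * C).trace := by
    have hD : Uᵀ * U - Xᵀ * X = Xᵀ * Δ + Δᵀ * X + Δᵀ * Δ := by
      rw [hUe]; simp only [Matrix.transpose_add, Matrix.add_mul, Matrix.mul_add]; abel
    have hDT : (Xᵀ * Δ + Δᵀ * X + Δᵀ * Δ)ᵀ = Xᵀ * Δ + Δᵀ * X + Δᵀ * Δ := by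
      simp only [Matrix.transpose_add, Matrix.transpose_mul, Matrix.transpose_transpose]; abel
    rw [hD, frobNorm_sq, hDT]
    simp only [Matrix.add_mul, Matrix.mul_add, Matrix.trace_add, trace_mul_mul_mul_cycle,
      ← hA, ← hBdef, ← hC, ← hB, Matrix.trace_mul_comm B A, Matrix.trace_mul_comm C A]
    ring
  have h1 : 0 ≤ ((A + √2 • B) * (A + √2 • B)).trace :=
    trace_mul_self_nonneg (by simp [hAT, hBT])
  have h2 : 0 ≤ (A * (B + C)).trace := by
    have : B + C = X * Uᵀ := by rw [← hsym, hUe, hBdef, hC, Matrix.add_mul, add_comm]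
    rw [this]
    exact trace_mul_nonneg_of_posSemidef hU Δ
  have h3 := trace_mul_nonneg_of_posSemidef hs Δ
  have h2' : √2 * √2 = 2 := by norm_num
  have h2'' : 1 ≤ √2 := by rw [Real.one_le_sqrt]; norm_num
  have h2''' : √2 ≤ 2 := by nlinarith
  rw [← hA] at h3
  rw [key, frobNorm_sq, ← hA]
  have e1 : ((A + √2 • B) * (A + √2 • B)).trace =
      (A * A).trace + 2 * √2 * (A * B).trace + 2 * (B * B).trace := by
    simp only [Matrix.add_mul, Matrix.mul_add, Matrix.trace_add, Matrix.smul_mul, Matrix.mul_smul,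
      Matrix.trace_smul, smul_eq_mul, Matrix.trace_mul_comm B A]
    linear_combination (B * B).trace * h2'
  rw [e1] at h1
  simp only [Matrix.mul_add, Matrix.mul_sub, Matrix.trace_add, Matrix.trace_sub, Matrix.mul_smul,
      Matrix.trace_smul, smul_eq_mul, Matrix.mul_one] at h2 h3
  nlinarith [mul_nonneg (sub_nonneg.2 h2''') h2, mul_nonneg (sub_nonneg.2 h2'') h3]

/-- First-order version of the previous bound, sharp for small perturbations: on aligned
representatives the linear part `Xᵀ Δ + Δᵀ X` of the Gram perturbation has Frobenius norm at least
`√2 s ‖Δ‖`. -/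
theorem frobNorm_gram_sub_ge {d k : ℕ} {X U : Matrix (Fin d) (Fin k) ℝ} {s : ℝ}
    (hs : (X * Xᵀ - s ^ 2 • (1 : Matrix (Fin d) (Fin d) ℝ)).PosSemidef)
    (hU : (X * Uᵀ).PosSemidef) :
    frobNorm (U - X) * (√2 * s - frobNorm (U - X)) ≤ frobNorm (Uᵀ * U - Xᵀ * X) := by
  have hsym : U * Xᵀ = X * Uᵀ := by
    simpa using hU.isHermitian.eq
  set Δ := U - X with hΔ
  have hUe : U = X + Δ := by simp [hΔ]
  have hB : Δ * Xᵀ = X * Δᵀ := by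
    simp only [hΔ, Matrix.sub_mul, Matrix.mul_sub, Matrix.transpose_sub, hsym]
  have hBT : (Δ * Xᵀ)ᵀ = Δ * Xᵀ := by
    rw [Matrix.transpose_mul, Matrix.transpose_transpose, ← hB]
  have hlin : Xᵀ * Δ + Δᵀ * X = (Uᵀ * U - Xᵀ * X) + -(Δᵀ * Δ) := by
    rw [hUe]; simp only [Matrix.transpose_add, Matrix.add_mul, Matrix.mul_add]; abel
  have hDT : (Xᵀ * Δ + Δᵀ * X)ᵀ = Xᵀ * Δ + Δᵀ * X := by
    simp only [Matrix.transpose_add, Matrix.transpose_mul, Matrix.transpose_transpose]; abel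
  have key : frobNorm (Xᵀ * Δ + Δᵀ * X) ^ 2 =
      2 * (Δ * Xᵀ * (Δ * Xᵀ)).trace + 2 * (Δ * Δᵀ * (X * Xᵀ)).trace := by
    rw [frobNorm_sq, hDT]
    simp only [Matrix.add_mul, Matrix.mul_add, Matrix.trace_add, trace_mul_mul_mul_cycle,
      ← hB, Matrix.trace_mul_comm (X * Xᵀ)]
    ring
  have h1 := trace_mul_self_nonneg hBT
  have h3 := trace_mul_nonneg_of_posSemidef hs Δ
  simp only [Matrix.mul_sub, Matrix.trace_sub, Matrix.mul_smul,
      Matrix.trace_smul, smul_eq_mul, Matrix.mul_one, ← frobNorm_sq] at h3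
  have h4 : √2 * s * frobNorm Δ ≤ frobNorm (Xᵀ * Δ + Δᵀ * X) := by
    refine le_of_sq_le_sq ?_ (frobNorm_nonneg _)
    rw [key, mul_pow, mul_pow, Real.sq_sqrt (by norm_num)]
    linarith
  have h5 := frobNorm_add_le (Uᵀ * U - Xᵀ * X) (-(Δᵀ * Δ))
  rw [← hlin, frobNorm_neg] at h5
  have h6 := frobNorm_transpose_mul_self_le Δ
  nlinarith

theorem rho_le_frobNorm {d k : ℕ} (X V : Matrix (Fin d) (Fin k) ℝ)
    (Q : Matrix.orthogonalGroup (Fin d) ℝ) :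
    rho (cloudClass X) (cloudClass V) ≤ frobNorm (X - (Q : Matrix (Fin d) (Fin d) ℝ) * V) :=
  ciInf_le ⟨0, by rintro _ ⟨R, rfl⟩; exact frobNorm_nonneg _⟩ Q

/-- Every class has a representative `U` aligned with `X`, with the same Gram matrix. -/
theorem exists_aligned {d k : ℕ} (X V : Matrix (Fin d) (Fin k) ℝ) :
    ∃ U : Matrix (Fin d) (Fin k) ℝ, Uᵀ * U = Vᵀ * V ∧ (X * Uᵀ).PosSemidef ∧
      rho (cloudClass X) (cloudClass V) ≤ frobNorm (U - X) := by
  obtain ⟨R, hR⟩ := exists_mul_orthogonal_posSemidef (X * Vᵀ)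
  have hRR : (R : Matrix (Fin d) (Fin d) ℝ) * (R : Matrix (Fin d) (Fin d) ℝ)ᵀ = 1 := by
    have := (Matrix.mem_orthogonalGroup_iff (Fin d) ℝ).mp R.2
    simpa [Matrix.star_eq_conjTranspose] using this
  refine ⟨(R : Matrix (Fin d) (Fin d) ℝ)ᵀ * V, ?_, ?_, ?_⟩
  · rw [Matrix.transpose_mul, Matrix.transpose_transpose, Matrix.mul_assoc,
      ← Matrix.mul_assoc _ _ V, hRR, Matrix.one_mul]
  · rwa [Matrix.transpose_mul, Matrix.transpose_transpose, ← Matrix.mul_assoc]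
  · rw [← frobNorm_neg, neg_sub]
    exact rho_le_frobNorm X V R⁻¹

/-- Global Procrustes bound for aligned representatives. -/
theorem frobNorm_sub_le_of_aligned {d k : ℕ} {X U : Matrix (Fin d) (Fin k) ℝ} {s : ℝ} (hs0 : 0 < s)
    (hs : (X * Xᵀ - s ^ 2 • (1 : Matrix (Fin d) (Fin d) ℝ)).PosSemidef)
    (hU : (X * Uᵀ).PosSemidef) :
    frobNorm (U - X) ≤ 1 / √(2 * (√2 - 1)) / s * frobNorm (Uᵀ * U - Xᵀ * X) := by
  have h := frobNorm_gram_sub_sq_ge hs hU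
  have h2 : 0 < 2 * (√2 - 1) := by
    have : 1 < √2 := by rw [Real.lt_sqrt] <;> norm_num
    linarith
  have h3 := Real.sqrt_pos.mpr h2
  rw [div_div, div_mul_eq_mul_div, one_mul, le_div_iff₀ (by positivity)]
  refine le_of_sq_le_sq ?_ (frobNorm_nonneg _)
  rw [mul_pow, mul_pow, Real.sq_sqrt h2.le]
  linarith

/-- Global Procrustes bound for the distance of classes. -/
theorem rho_le_of_posSemidef {d k : ℕ} {X : Matrix (Fin d) (Fin k) ℝ} {s : ℝ} (hs0 : 0 < s)
    (hs : (X * Xᵀ - s ^ 2 • (1 : Matrix (Fin d) (Fin d) ℝ)).PosSemidef)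
    (V : Matrix (Fin d) (Fin k) ℝ) :
    rho (cloudClass X) (cloudClass V) ≤
      1 / √(2 * (√2 - 1)) / s * frobNorm (Vᵀ * V - Xᵀ * X) := by
  obtain ⟨U, hUV, hU, hle⟩ := exists_aligned X V
  rw [← hUV]
  exact hle.trans (frobNorm_sub_le_of_aligned hs0 hs hU)

/-- Local Procrustes bound: when the Gram matrices are close enough, every constant larger than
`1 / √2` is admissible. -/
theorem rho_le_of_posSemidef_of_le {d k : ℕ} {X : Matrix (Fin d) (Fin k) ℝ} {s : ℝ} (hs0 : 0 < s)
    (hs : (X * Xᵀ - s ^ 2 • (1 : Matrix (Fin d) (Fin d) ℝ)).PosSemidef)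
    (V : Matrix (Fin d) (Fin k) ℝ) {L : ℝ} (hL : 0 < L)
    (hV : 1 / √(2 * (√2 - 1)) / s * frobNorm (Vᵀ * V - Xᵀ * X) ≤ s * (√2 - 1 / L)) :
    rho (cloudClass X) (cloudClass V) ≤ L / s * frobNorm (Vᵀ * V - Xᵀ * X) := by
  obtain ⟨U, hUV, hU, hle⟩ := exists_aligned X V
  rw [← hUV] at hV ⊢
  refine hle.trans ?_
  have h1 := (frobNorm_sub_le_of_aligned hs0 hs hU).trans hV
  have h2 := frobNorm_gram_sub_ge hs hU
  have h3 : s / L ≤ √2 * s - frobNorm (U - X) := by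
    have : s * (√2 - 1 / L) = √2 * s - s / L := by ring
    linarith
  have h4 := (mul_le_mul_of_nonneg_left h3 (frobNorm_nonneg (U - X))).trans h2
  rw [div_mul_eq_mul_div, le_div_iff₀ hs0]
  rw [mul_div_assoc', div_le_iff₀ hL] at h4
  linarith

/-! ### The smallest nonzero singular value -/

/-- For a surjective linear map, the last nonzero singular value bounds the adjoint from below. -/
theorem sq_singularValues_mul_le_norm_adjoint_sq {E F : Type*}
    [NormedAddCommGroup E] [InnerProductSpace ℝ E] [FiniteDimensional ℝ E]
    [NormedAddCommGroup F] [InnerProductSpace ℝ F] [FiniteDimensional ℝ F]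
    (T : E →ₗ[ℝ] F) (hT : Function.Surjective T) {n : ℕ} (hn : Module.finrank ℝ F = n + 1) (w : F) :
    T.singularValues n ^ 2 * ‖w‖ ^ 2 ≤ ‖T.adjoint w‖ ^ 2 := by
  obtain ⟨y, rfl⟩ := hT w
  set b := T.isSymmetric_adjoint_comp_self.eigenvectorBasis rfl
  set e := T.isSymmetric_adjoint_comp_self.eigenvalues rfl with he
  have hb : ∀ j, inner ℝ (b j) (T.adjoint (T y)) = e j * inner ℝ (b j) y := fun j => by
    have h1 : T.adjoint (T (b j)) = e j • b j :=
      T.isSymmetric_adjoint_comp_self.apply_eigenvectorBasis rfl j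
    rw [LinearMap.adjoint_inner_right, ← LinearMap.adjoint_inner_left, h1, real_inner_smul_left]
  have h1 : ‖T y‖ ^ 2 = ∑ j, e j * inner ℝ (b j) y ^ 2 := by
    rw [← real_inner_self_eq_norm_sq, ← LinearMap.adjoint_inner_right,
      ← b.sum_inner_mul_inner]
    refine Finset.sum_congr rfl fun j _ => ?_
    rw [hb, real_inner_comm]; ring
  have h2 : ‖T.adjoint (T y)‖ ^ 2 = ∑ j, e j ^ 2 * inner ℝ (b j) y ^ 2 := by
    rw [← b.sum_sq_norm_inner_right]
    refine Finset.sum_congr rfl fun j _ => ?_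
    rw [hb, Real.norm_eq_abs, sq_abs]; ring
  rw [h1, h2, Finset.mul_sum]
  refine Finset.sum_le_sum fun j _ => ?_
  rw [← mul_assoc]
  refine mul_le_mul_of_nonneg_right ?_ (sq_nonneg _)
  rw [he, ← T.sq_singularValues_fin rfl j, sq (T.singularValues j ^ 2)]
  rcases le_or_gt (j : ℕ) n with hjn | hjn
  · exact mul_le_mul_of_nonneg_right (pow_le_pow_left₀ (T.singularValues_nonneg n)
      (T.singularValues_antitone hjn) 2) (sq_nonneg _)
  -- beyond the rank all singular values vanish
  · have : T.singularValues j = 0 := by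
      rw [T.singularValues_eq_zero_iff_le_finrank_range, LinearMap.range_eq_top.mpr hT,
        finrank_top, hn]
      exact hjn
    simp [this]

theorem finrank_range_toEuclideanLin {m n : ℕ} (A : Matrix (Fin m) (Fin n) ℝ) :
    Module.finrank ℝ (Matrix.toEuclideanLin A).range = A.rank := by
  rw [A.rank_eq_finrank_range_toLin (EuclideanSpace.basisFun (Fin m) ℝ).toBasis
    (EuclideanSpace.basisFun (Fin n) ℝ).toBasis, ← Matrix.toEuclideanLin_eq_toLin_orthonormal]

theorem singularValue_pos {d k : ℕ} (hd : 0 < d) {X : Matrix (Fin d) (Fin k) ℝ}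
    (hX : X.rank = d) : 0 < singularValue X d := by
  rw [singularValue, LinearMap.singularValues_pos_iff_lt_finrank_range,
    finrank_range_toEuclideanLin, hX]
  omega

theorem posSemidef_mul_transpose_sub_singularValue {d k : ℕ} (hd : 0 < d)
    {X : Matrix (Fin d) (Fin k) ℝ} (hX : X.rank = d) :
    (X * Xᵀ - singularValue X d ^ 2 • (1 : Matrix (Fin d) (Fin d) ℝ)).PosSemidef := by
  refine Matrix.PosSemidef.of_dotProduct_mulVec_nonneg ?_ fun x => ?_
  · rw [Matrix.IsHermitian, Matrix.conjTranspose_eq_transpose_of_trivial]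
    simp
  have hsurj : Function.Surjective (Matrix.toEuclideanLin X) := by
    rw [← LinearMap.range_eq_top]
    apply Submodule.eq_top_of_finrank_eq
    rw [finrank_range_toEuclideanLin, hX, finrank_euclideanSpace_fin]
  have h := sq_singularValues_mul_le_norm_adjoint_sq _ hsurj (n := d - 1)
    (by rw [finrank_euclideanSpace_fin]; omega) (WithLp.toLp 2 x)
  rw [← Matrix.toEuclideanLin_conjTranspose_eq_adjoint,
    Matrix.conjTranspose_eq_transpose_of_trivial, norm_toEuclideanLin_sq,
    ← real_inner_self_eq_norm_sq, EuclideanSpace.inner_eq_star_dotProduct] at h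
  simp only [star_trivial, Matrix.transpose_transpose] at h
  rw [star_trivial, Matrix.sub_mulVec, dotProduct_sub, Matrix.smul_mulVec, Matrix.one_mulVec,
    dotProduct_smul, smul_eq_mul, sub_nonneg]
  exact h

/-! ### The spectral estimator -/

/-- The quadratic form of a matrix on Euclidean space. -/
noncomputable def quadForm {k : ℕ} (A : Matrix (Fin k) (Fin k) ℝ)
    (u : EuclideanSpace ℝ (Fin k)) : ℝ :=
  inner ℝ u (Matrix.toEuclideanLin A u)

theorem quadForm_sub {k : ℕ} (A B : Matrix (Fin k) (Fin k) ℝ) (u : EuclideanSpace ℝ (Fin k)) :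
    quadForm (A - B) u = quadForm A u - quadForm B u := by
  simp [quadForm, inner_sub_right]

theorem quadForm_transpose_mul_self {d k : ℕ} (X : Matrix (Fin d) (Fin k) ℝ)
    (u : EuclideanSpace ℝ (Fin k)) :
    quadForm (Xᵀ * X) u = ‖Matrix.toEuclideanLin X u‖ ^ 2 := by
  rw [norm_toEuclideanLin_sq, quadForm, EuclideanSpace.inner_eq_star_dotProduct, dotProduct_comm]
  simp [Matrix.toLpLin_apply]

theorem frobNorm_sq_eq_sum_eigenvalues_sq {k : ℕ} {D : Matrix (Fin k) (Fin k) ℝ}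
    (hD : D.IsHermitian) : frobNorm D ^ 2 = ∑ i, hD.eigenvalues i ^ 2 := by
  have hT : Dᵀ = D := by simpa using hD.eq
  rw [frobNorm_sq, hT]
  conv_lhs => rw [hD.spectral_theorem, ← map_mul, Matrix.diagonal_mul_diagonal]
  rw [Unitary.conjStarAlgAut_apply, Matrix.trace_mul_cycle]
  simp [Matrix.trace, sq]

/-- A symmetric matrix of rank at most `r` has Frobenius norm at most `√r` times its operator norm,
the latter being controlled by the quadratic form. -/
theorem frobNorm_le_sqrt_rank_mul {k r : ℕ} {D : Matrix (Fin k) (Fin k) ℝ}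
    (hD : D.IsHermitian) (hr : D.rank ≤ r) {c : ℝ} (hc : 0 ≤ c)
    (h : ∀ u, |quadForm D u| ≤ c * ‖u‖ ^ 2) : frobNorm D ≤ √r * c := by
  refine le_of_sq_le_sq ?_ (by positivity)
  rw [frobNorm_sq_eq_sum_eigenvalues_sq hD, mul_pow, Real.sq_sqrt (by positivity)]
  have he : ∀ i, |hD.eigenvalues i| ≤ c := fun i => by
    have h1 := h (hD.eigenvectorBasis i)
    have h2 : quadForm D (hD.eigenvectorBasis i) = hD.eigenvalues i := by
      rw [quadForm, Matrix.toLpLin_apply, hD.mulVec_eigenvectorBasis, WithLp.toLp_smul,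
        real_inner_smul_right, real_inner_self_eq_norm_sq]
      simp
    simpa [h2] using h1
  rw [hD.rank_eq_card_non_zero_eigs, Fintype.card_subtype] at hr
  calc ∑ i, hD.eigenvalues i ^ 2
      = ∑ i with hD.eigenvalues i ≠ 0, hD.eigenvalues i ^ 2 := by
        rw [Finset.sum_filter_of_ne]
        intro i _ hi h0
        simp [h0] at hi
    _ ≤ ∑ i with hD.eigenvalues i ≠ 0, c ^ 2 :=
        Finset.sum_le_sum fun i _ => sq_le_sq' (abs_le.1 (he i)).1 (abs_le.1 (he i)).2
    _ ≤ r * c ^ 2 := by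
        rw [Finset.sum_const, nsmul_eq_mul]
        gcongr

theorem sum_fin_dite_lt {d k : ℕ} (hdk : d ≤ k) (f : Fin k → ℝ) :
    (∑ i : Fin d, if h : (i : ℕ) < k then f ⟨i, h⟩ else 0) =
      ∑ j : Fin k, if (j : ℕ) < d then f j else 0 := by
  obtain ⟨m, rfl⟩ := Nat.exists_eq_add_of_le hdk
  rw [Fin.sum_univ_add]
  simp
  refine Finset.sum_congr rfl fun i _ => ?_
  rw [dif_pos (by omega)]
  rfl

theorem norm_toEuclideanLin_gramFactor_sq {d k : ℕ} (hdk : d ≤ k) (eig : Fin k → ℝ)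
    (v : Fin k → EuclideanSpace ℝ (Fin k)) (u : EuclideanSpace ℝ (Fin k)) :
    ‖Matrix.toEuclideanLin (gramFactor d eig v) u‖ ^ 2 =
      ∑ j : Fin k, (if (j : ℕ) < d then max (eig j) 0 else 0) * inner ℝ (v j) u ^ 2 := by
  have h := sum_fin_dite_lt hdk fun j => max (eig j) 0 * inner ℝ (v j) u ^ 2
  simp only [ite_mul, zero_mul]
  rw [← h, EuclideanSpace.norm_sq_eq]
  refine Finset.sum_congr rfl fun i _ => ?_
  rw [Matrix.toLpLin_apply, Real.norm_eq_abs, sq_abs]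
  split_ifs with hi
  · simp only [gramFactor, Matrix.mulVec, dotProduct, Matrix.of_apply, dif_pos hi, mul_assoc]
    rw [← Finset.mul_sum, mul_pow, Real.sq_sqrt (le_max_right _ _)]
    congr 2
    rw [EuclideanSpace.inner_eq_star_dotProduct, dotProduct_comm]
    rfl
  · simp [gramFactor, Matrix.mulVec, dotProduct, hi]

section Eigenbasis

variable {d k : ℕ} {H : Matrix (Fin k) (Fin k) ℝ} {eig : Fin k → ℝ}
  {v : OrthonormalBasis (Fin k) ℝ (EuclideanSpace ℝ (Fin k))}

theorem quadForm_eq_sum_eigenbasis (hH : ∀ j, Matrix.toEuclideanLin H (v j) = eig j • v j)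
    (u : EuclideanSpace ℝ (Fin k)) : quadForm H u = ∑ j, eig j * inner ℝ (v j) u ^ 2 := by
  have h1 : Matrix.toEuclideanLin H u = ∑ j, (inner ℝ (v j) u * eig j) • v j := by
    conv_lhs => rw [← v.sum_repr' u]
    simp [map_sum, hH, smul_smul]
  rw [quadForm, h1, inner_sum]
  refine Finset.sum_congr rfl fun j _ => ?_
  rw [real_inner_smul_right, real_inner_comm]
  ring

/-- Half of Weyl's inequality: a small perturbation of a positive semidefinite matrix has
no eigenvalue much below zero. -/
theorem neg_le_eigenvalue (hH : ∀ j, Matrix.toEuclideanLin H (v j) = eig j • v j)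
    {X : Matrix (Fin d) (Fin k) ℝ} {t : ℝ} (ht : ∀ u, |quadForm (H - Xᵀ * X) u| ≤ t * ‖u‖ ^ 2)
    (j : Fin k) : -t ≤ eig j := by
  have h1 := (abs_le.1 (ht (v j))).1
  have h2 : quadForm H (v j) = eig j := by
    rw [quadForm, hH, real_inner_smul_right, real_inner_self_eq_norm_sq]; simp
  rw [quadForm_sub, h2, quadForm_transpose_mul_self, v.norm_eq_one] at h1
  nlinarith [sq_nonneg ‖Matrix.toEuclideanLin X (v j)‖]

/-- Half of Weyl's inequality: a small perturbation of a matrix of rank at most `d` has only `d`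
large eigenvalues, since the span of the first `d + 1` eigenvectors meets the kernel of `X`. -/
theorem eigenvalue_le_of_le (heig : Antitone eig)
    (hH : ∀ j, Matrix.toEuclideanLin H (v j) = eig j • v j)
    {X : Matrix (Fin d) (Fin k) ℝ} {t : ℝ} (ht : ∀ u, |quadForm (H - Xᵀ * X) u| ≤ t * ‖u‖ ^ 2)
    (j : Fin k) (hj : d ≤ j) : eig j ≤ t := by
  let ι : Fin (d + 1) → Fin k := fun l => ⟨l, by omega⟩
  have hι : Function.Injective ι := fun a b hab => by
    ext; simpa [ι] using hab
  let f : (Fin (d + 1) → ℝ) →ₗ[ℝ] EuclideanSpace ℝ (Fin d) :=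
    Matrix.toEuclideanLin X ∘ₗ Fintype.linearCombination ℝ (fun l => v (ι l))
  have hker : f.ker ≠ ⊥ := LinearMap.ker_ne_bot_of_finrank_lt (by simp)
  obtain ⟨c, hc, hc0⟩ := Submodule.exists_mem_ne_zero_of_ne_bot hker
  set u := ∑ l, c l • v (ι l) with hu
  have hXu : Matrix.toEuclideanLin X u = 0 := by
    simpa [f, hu, Fintype.linearCombination_apply] using hc
  have hon : Orthonormal ℝ (fun l => v (ι l)) := v.orthonormal.comp ι hι
  have hu2 : ‖u‖ ^ 2 = ∑ l, c l ^ 2 := by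
    rw [← real_inner_self_eq_norm_sq, hu, hon.inner_sum]
    simp [sq]
  have hHu : quadForm H u = ∑ l, eig (ι l) * c l ^ 2 := by
    rw [quadForm, hu]
    simp only [map_sum, map_smul, hH, smul_smul]
    rw [hon.inner_sum]
    refine Finset.sum_congr rfl fun l _ => ?_
    simp; ring
  have hpos : 0 < ∑ l, c l ^ 2 := by
    obtain ⟨l, hl⟩ := Function.ne_iff.mp hc0
    exact Finset.sum_pos' (fun _ _ => sq_nonneg _) ⟨l, Finset.mem_univ _, sq_pos_iff.mpr hl⟩
  have h1 := (abs_le.1 (ht u)).2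
  rw [quadForm_sub, quadForm_transpose_mul_self, hXu, hHu, hu2] at h1
  have h2 : eig j * ∑ l, c l ^ 2 ≤ ∑ l, eig (ι l) * c l ^ 2 := by
    rw [Finset.mul_sum]
    refine Finset.sum_le_sum fun l _ => mul_le_mul_of_nonneg_right (heig ?_) (sq_nonneg _)
    change (l : ℕ) ≤ j
    omega
  refine le_of_mul_le_mul_right ?_ hpos
  simp at h1
  linarith

/-- The truncation of `H` to its `d` largest eigenvalues, clipped at zero, is as close to `H`
as the given matrix `Xᵀ X`. -/
theorem abs_quadForm_gramFactor_sub_le (hdk : d ≤ k) (heig : Antitone eig)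
    (hH : ∀ j, Matrix.toEuclideanLin H (v j) = eig j • v j)
    {X : Matrix (Fin d) (Fin k) ℝ} {t : ℝ} (ht : ∀ u, |quadForm (H - Xᵀ * X) u| ≤ t * ‖u‖ ^ 2)
    (u : EuclideanSpace ℝ (Fin k)) :
    |quadForm ((gramFactor d eig v)ᵀ * gramFactor d eig v - H) u| ≤ t * ‖u‖ ^ 2 := by
  have ht0 : ∀ j : Fin k, 0 ≤ t := fun j => by
    simpa using (abs_nonneg _).trans (ht (v j))
  rw [quadForm_sub, quadForm_transpose_mul_self, norm_toEuclideanLin_gramFactor_sq hdk,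
    quadForm_eq_sum_eigenbasis hH, ← Finset.sum_sub_distrib, ← v.sum_sq_norm_inner_right,
    Finset.mul_sum]
  refine (Finset.abs_sum_le_sum_abs _ _).trans (Finset.sum_le_sum fun j _ => ?_)
  rw [← sub_mul, abs_mul, abs_of_nonneg (sq_nonneg (inner ℝ (v j) u)), Real.norm_eq_abs, sq_abs]
  refine mul_le_mul_of_nonneg_right ?_ (sq_nonneg _)
  have h1 := neg_le_eigenvalue hH ht j
  have h0 := ht0 j
  split_ifs with hj
  · rcases le_total (eig j) 0 with h | h
    · rw [max_eq_right h, abs_le]; constructor <;> linarith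
    · rw [max_eq_left h]; simpa using h0
  · have h2 := eigenvalue_le_of_le heig hH ht j (by omega)
    rw [abs_le]; constructor <;> linarith

theorem frobNorm_gramFactor_sub_le (hdk : d ≤ k) (heig : Antitone eig)
    (hH : ∀ j, Matrix.toEuclideanLin H (v j) = eig j • v j)
    {X : Matrix (Fin d) (Fin k) ℝ} {t : ℝ} (ht0 : 0 ≤ t)
    (ht : ∀ u, |quadForm (H - Xᵀ * X) u| ≤ t * ‖u‖ ^ 2) :
    frobNorm ((gramFactor d eig v)ᵀ * gramFactor d eig v - Xᵀ * X) ≤ √(2 * d) * (2 * t) := by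
  set V := gramFactor d eig v
  have hherm : (Vᵀ * V - Xᵀ * X).IsHermitian := by
    rw [Matrix.IsHermitian, Matrix.conjTranspose_eq_transpose_of_trivial]
    simp
  have hrank : (Vᵀ * V - Xᵀ * X).rank ≤ 2 * d := by
    have : Vᵀ * V - Xᵀ * X = Matrix.fromCols Vᵀ (-Xᵀ) * Matrix.fromRows V X := by
      rw [Matrix.fromCols_mul_fromRows, Matrix.neg_mul, sub_eq_add_neg]
    rw [this]
    refine (Matrix.rank_mul_le_left _ _).trans ((Matrix.rank_le_card_width _).trans ?_)
    simp [two_mul]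
  have h := frobNorm_le_sqrt_rank_mul hherm hrank (c := 2 * t) (by positivity) fun u => by
    have h1 := ht u
    have h2 := abs_quadForm_gramFactor_sub_le hdk heig hH ht u
    rw [quadForm_sub] at h1 h2 ⊢
    rw [abs_le] at h1 h2 ⊢
    constructor <;> linarith [h1.1, h1.2, h2.1, h2.2]
  exact_mod_cast h

end Eigenbasis

/-! ### Symmetric nets of the unit sphere -/

/-- Volume bound for a separated set of directions. Since antipodal points are identified, the balls
around the points and around their antipodes are disjoint, which gains a factor `2`. -/
theorem two_mul_card_le_of_separated {E : Type*} [NormedAddCommGroup E] [NormedSpace ℝ E]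
    [FiniteDimensional ℝ E] (s : Finset E) (hs : ∀ c ∈ s, ‖c‖ = 1)
    (h : ∀ c ∈ s, ∀ d ∈ s, c ≠ d → 1 / 4 ≤ ‖c - d‖ ∧ 1 / 4 ≤ ‖c + d‖) :
    2 * s.card ≤ 9 ^ Module.finrank ℝ E := by
  classical
  borelize E
  let μ : Measure E := Measure.addHaar
  set t : Finset E := s ∪ s.image Neg.neg with ht
  have hdisj : Disjoint s (s.image Neg.neg) := by
    rw [Finset.disjoint_left]
    intro c hc hc'
    obtain ⟨d, hd, rfl⟩ := Finset.mem_image.mp hc'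
    by_cases hcd : -d = d
    · have : d = 0 := by simpa [neg_eq_iff_add_eq_zero, ← two_smul ℝ d] using hcd
      simpa [this] using hs d hd
    · have := (h _ hc d hd hcd).2
      norm_num at this
  have hcard : t.card = 2 * s.card := by
    rw [ht, Finset.card_union_of_disjoint hdisj, Finset.card_image_of_injective _ neg_injective,
      two_mul]
  have htn : ∀ c ∈ t, ‖c‖ = 1 := by
    intro c hc
    rcases Finset.mem_union.mp hc with hc | hc
    · exact hs c hc
    · obtain ⟨d, hd, rfl⟩ := Finset.mem_image.mp hc
      rw [norm_neg, hs d hd]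
  have hself : ∀ c ∈ s, 1 / 4 ≤ ‖c + c‖ := fun c hc => by
    rw [← two_smul ℝ c, norm_smul, hs c hc]; norm_num
  have hsep : ∀ c ∈ t, ∀ d ∈ t, c ≠ d → 1 / 4 ≤ ‖c - d‖ := by
    have hadd : ∀ c ∈ s, ∀ d ∈ s, 1 / 4 ≤ ‖c + d‖ := fun c hc d hd => by
      by_cases hcd : c = d
      · subst hcd; exact hself c hc
      · exact (h c hc d hd hcd).2
    intro c hc d hd hcd
    rcases Finset.mem_union.mp hc with hc | hc <;> rcases Finset.mem_union.mp hd with hd | hd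
    · exact (h c hc d hd hcd).1
    · obtain ⟨d', hd', rfl⟩ := Finset.mem_image.mp hd
      rw [sub_neg_eq_add]; exact hadd c hc d' hd'
    · obtain ⟨c', hc', rfl⟩ := Finset.mem_image.mp hc
      rw [← norm_neg, neg_sub, sub_neg_eq_add]; exact hadd d hd c' hc'
    · obtain ⟨d', hd', rfl⟩ := Finset.mem_image.mp hd
      obtain ⟨c', hc', rfl⟩ := Finset.mem_image.mp hc
      rw [neg_sub_neg]
      exact (h d' hd' c' hc' fun h' => hcd (by rw [h'])).1
  have D : Set.Pairwise (t : Set E)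
      (Function.onFun Disjoint fun c => Metric.ball c (1 / 8 : ℝ)) := by
    rintro c hc d hd hcd
    apply Metric.ball_disjoint_ball
    rw [dist_eq_norm]
    have := hsep c hc d hd hcd
    linarith
  have A_subset : (⋃ c ∈ t, Metric.ball c (1 / 8 : ℝ)) ⊆ Metric.ball (0 : E) (9 / 8 : ℝ) := by
    refine Set.iUnion₂_subset fun x hx => Metric.ball_subset_ball' ?_
    rw [dist_zero_right, htn x hx]; norm_num
  have I : (t.card : ENNReal) * ENNReal.ofReal ((1 / 8) ^ Module.finrank ℝ E) *
      μ (Metric.ball 0 1) ≤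
      ENNReal.ofReal ((9 / 8) ^ Module.finrank ℝ E) * μ (Metric.ball 0 1) :=
    calc
      _ = μ (⋃ c ∈ t, Metric.ball c (1 / 8 : ℝ)) := by
        rw [measure_biUnion_finset D fun c _ => measurableSet_ball]
        simp only [μ.addHaar_ball_of_pos _ (show (0 : ℝ) < 1 / 8 by norm_num)]
        simp only [Finset.sum_const, nsmul_eq_mul, mul_assoc]
      _ ≤ μ (Metric.ball (0 : E) (9 / 8 : ℝ)) := measure_mono A_subset
      _ = _ := by
        simp only [μ.addHaar_ball_of_pos _ (show (0 : ℝ) < 9 / 8 by norm_num)]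
  have J : (t.card : ENNReal) * ENNReal.ofReal ((1 / 8) ^ Module.finrank ℝ E) ≤
      ENNReal.ofReal ((9 / 8) ^ Module.finrank ℝ E) :=
    (ENNReal.mul_le_mul_iff_left (Metric.measure_ball_pos _ _ zero_lt_one).ne'
      measure_ball_lt_top.ne).1 I
  have K : (t.card : ℝ) ≤ (9 : ℝ) ^ Module.finrank ℝ E := by
    have := ENNReal.toReal_le_of_le_ofReal (by positivity) J
    simpa [div_eq_mul_inv, mul_pow] using this
  rw [hcard] at K
  exact_mod_cast K

/-- A net of at most `9 ^ dim / 2` unit vectors meeting, up to sign, the `1 / 4`-neighbourhood of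
every unit vector. -/
theorem exists_symmetric_net (E : Type*) [NormedAddCommGroup E] [NormedSpace ℝ E]
    [FiniteDimensional ℝ E] :
    ∃ T : Finset E, (∀ c ∈ T, ‖c‖ = 1) ∧ 2 * T.card ≤ 9 ^ Module.finrank ℝ E ∧
      ∀ u : E, ‖u‖ = 1 → ∃ c ∈ T, ‖u - c‖ ≤ 1 / 4 ∨ ‖u + c‖ ≤ 1 / 4 := by
  classical
  let P : Finset E → Prop := fun s => (∀ c ∈ s, ‖c‖ = 1) ∧
    ∀ c ∈ s, ∀ d ∈ s, c ≠ d → 1 / 4 ≤ ‖c - d‖ ∧ 1 / 4 ≤ ‖c + d‖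
  have hP : ∀ s, P s → 2 * s.card ≤ 9 ^ Module.finrank ℝ E := fun s hs =>
    two_mul_card_le_of_separated s hs.1 hs.2
  -- a separated set of maximal cardinality is a net
  obtain ⟨n, ⟨T, hT, rfl⟩, hmax⟩ : ∃ n, (∃ s, P s ∧ s.card = n) ∧
      ∀ m, (∃ s, P s ∧ s.card = m) → m ≤ n := by
    have hbdd : ∀ m, (∃ s, P s ∧ s.card = m) → m ≤ 9 ^ Module.finrank ℝ E := by
      rintro m ⟨s, hs, rfl⟩
      have := hP s hs
      omega
    have hne : ∃ m, (∃ s, P s ∧ s.card = m) := ⟨0, ∅, ⟨by simp, by simp⟩, rfl⟩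
    exact ⟨_, Nat.sSup_mem hne ⟨_, hbdd⟩, fun m hm => le_csSup ⟨_, hbdd⟩ hm⟩
  refine ⟨T, hT.1, hP T hT, fun u hu => ?_⟩
  by_contra! hcon
  have huT : u ∉ T := fun h => by
    have := (hcon u h).1
    norm_num at this
  have := hmax (insert u T).card ⟨insert u T, ⟨?_, ?_⟩, rfl⟩
  · rw [Finset.card_insert_of_notMem huT] at this
    omega
  · intro c hc
    rcases Finset.mem_insert.mp hc with rfl | hc
    exacts [hu, hT.1 c hc]
  · intro c hc d hd hcd
    rcases Finset.mem_insert.mp hc with hc | hc <;> rcases Finset.mem_insert.mp hd with hd | hd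
    · exact absurd (hc.trans hd.symm) hcd
    · rw [hc]; exact ⟨(hcon d hd).1.le, (hcon d hd).2.le⟩
    · rw [hd, ← norm_neg, neg_sub, add_comm]; exact ⟨(hcon c hc).1.le, (hcon c hc).2.le⟩
    · exact hT.2 c hc d hd hcd

theorem quadForm_smul {k : ℕ} (A : Matrix (Fin k) (Fin k) ℝ) (a : ℝ)
    (u : EuclideanSpace ℝ (Fin k)) : quadForm A (a • u) = a ^ 2 * quadForm A u := by
  simp only [quadForm, map_smul, real_inner_smul_left, real_inner_smul_right]
  ring

theorem quadForm_neg_right {k : ℕ} (A : Matrix (Fin k) (Fin k) ℝ)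
    (u : EuclideanSpace ℝ (Fin k)) : quadForm A (-u) = quadForm A u := by
  simp [quadForm]

/-- A bound for a quadratic form on a symmetric `1 / 4`-net extends to the whole space at the price
of a factor `2`. -/
theorem abs_quadForm_le_of_net {k : ℕ} {A : Matrix (Fin k) (Fin k) ℝ}
    {T : Finset (EuclideanSpace ℝ (Fin k))} (hT : ∀ c ∈ T, ‖c‖ = 1)
    (hnet : ∀ u : EuclideanSpace ℝ (Fin k), ‖u‖ = 1 →
      ∃ c ∈ T, ‖u - c‖ ≤ 1 / 4 ∨ ‖u + c‖ ≤ 1 / 4)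
    {m : ℝ} (hm : ∀ c ∈ T, |quadForm A c| ≤ m) (u : EuclideanSpace ℝ (Fin k)) :
    |quadForm A u| ≤ 2 * m * ‖u‖ ^ 2 := by
  rcases eq_or_ne u 0 with rfl | hu0
  · simp [quadForm]
  have hunit : ∀ {w : EuclideanSpace ℝ (Fin k)}, w ≠ 0 → ‖(‖w‖⁻¹ • w)‖ = 1 := fun {w} hw => by
    rw [norm_smul, norm_inv, norm_norm, inv_mul_cancel₀ (norm_ne_zero_iff.mpr hw)]
  have hcont : Continuous fun u : EuclideanSpace ℝ (Fin k) => |quadForm A u| := by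
    have : Continuous (Matrix.toEuclideanLin A) := LinearMap.continuous_of_finiteDimensional _
    unfold quadForm
    fun_prop
  obtain ⟨w, hw, hmax⟩ := (isCompact_sphere (0 : EuclideanSpace ℝ (Fin k)) 1).exists_isMaxOn
    ⟨_, mem_sphere_zero_iff_norm.mpr (hunit hu0)⟩ hcont.continuousOn
  rw [mem_sphere_zero_iff_norm] at hw
  set M := |quadForm A w| with hM
  have hall : ∀ x, |quadForm A x| ≤ M * ‖x‖ ^ 2 := fun x => by
    rcases eq_or_ne x 0 with rfl | hx0
    · simp [quadForm]
    have h1 : |quadForm A (‖x‖⁻¹ • x)| ≤ M := hmax (mem_sphere_zero_iff_norm.mpr (hunit hx0))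
    rw [quadForm_smul, abs_mul, abs_of_nonneg (sq_nonneg _), inv_pow,
      inv_mul_le_iff₀ (by positivity)] at h1
    linarith
  -- polarization with the pair `8 (x - y)`, `x + y`, whose norms are balanced for `‖x - y‖ = 1 / 4`
  have hdiff : ∀ x y : EuclideanSpace ℝ (Fin k), ‖x‖ = 1 → ‖y‖ = 1 → ‖x - y‖ ≤ 1 / 4 →
      quadForm A x - quadForm A y ≤ M / 2 ∧ -(M / 2) ≤ quadForm A x - quadForm A y := by
    intro x y hx hy hxy
    have h1 : quadForm A ((9 : ℝ) • x - (7 : ℝ) • y) - quadForm A ((7 : ℝ) • x - (9 : ℝ) • y) =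
        32 * (quadForm A x - quadForm A y) := by
      simp only [quadForm, map_sub, map_smul, inner_sub_left, inner_sub_right,
        real_inner_smul_left, real_inner_smul_right]
      ring
    have h2 : ‖(9 : ℝ) • x - (7 : ℝ) • y‖ ^ 2 + ‖(7 : ℝ) • x - (9 : ℝ) • y‖ ^ 2 =
        8 + 126 * ‖x - y‖ ^ 2 := by
      simp only [@norm_sub_sq_real, norm_smul, real_inner_smul_left, real_inner_smul_right, hx, hy]
      norm_num
      ring
    have h3 : ‖x - y‖ ^ 2 ≤ (1 / 4) ^ 2 := pow_le_pow_left₀ (norm_nonneg _) hxy 2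
    have h4 := abs_le.1 (hall ((9 : ℝ) • x - (7 : ℝ) • y))
    have h5 := abs_le.1 (hall ((7 : ℝ) • x - (9 : ℝ) • y))
    have hM0 : 0 ≤ M := abs_nonneg _
    have h6 : M * ‖(9 : ℝ) • x - (7 : ℝ) • y‖ ^ 2 + M * ‖(7 : ℝ) • x - (9 : ℝ) • y‖ ^ 2 ≤
        16 * M := by
      rw [← mul_add, h2]
      nlinarith
    constructor <;> linarith [h4.1, h4.2, h5.1, h5.2]
  have hMm : M ≤ 2 * m := by
    obtain ⟨c, hc, hcw⟩ := hnet w hw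
    have h1 : |quadForm A w - quadForm A c| ≤ M / 2 := by
      rcases hcw with h | h
      · have := hdiff w c hw (hT c hc) h
        exact abs_le.mpr ⟨this.2, this.1⟩
      · have := hdiff w (-c) hw (by rw [norm_neg, hT c hc]) (by rwa [sub_neg_eq_add])
        rw [quadForm_neg_right] at this
        exact abs_le.mpr ⟨this.2, this.1⟩
    have h2 := abs_sub_abs_le_abs_sub (quadForm A w) (quadForm A c)
    have h3 := hm c hc
    linarith
  exact (hall u).trans (mul_le_mul_of_nonneg_right hMm (sq_nonneg _))

/-! ### Exponential moments of noncentral chi-squared variables -/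

theorem integral_exp_mul_sq_gaussianReal (a σ s : ℝ) (hs : 2 * s * σ ^ 2 < 1) :
    ∫ x, Real.exp (s * (a + σ * x) ^ 2) ∂(gaussianReal 0 1) =
      (√(1 - 2 * s * σ ^ 2))⁻¹ * Real.exp (s * a ^ 2 / (1 - 2 * s * σ ^ 2)) := by
  set w := 1 - 2 * s * σ ^ 2 with hw
  have hw0 : 0 < w := by linarith
  rw [integral_gaussianReal_eq_integral_smul one_ne_zero]
  have h1 : ∀ x : ℝ, gaussianPDFReal 0 1 x • Real.exp (s * (a + σ * x) ^ 2) =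
      (√(2 * Real.pi))⁻¹ * Real.exp (s * a ^ 2 / w) *
        Real.exp (-(w / 2) * (x - 2 * s * a * σ / w) ^ 2) := fun x => by
    rw [gaussianPDFReal, smul_eq_mul, mul_assoc, ← Real.exp_add, mul_assoc (√(2 * Real.pi))⁻¹,
      ← Real.exp_add]
    simp only [NNReal.coe_one, mul_one, sub_zero]
    congr 2
    field_simp
    rw [hw]
    ring
  simp_rw [h1]
  rw [integral_const_mul,
    integral_sub_right_eq_self (fun x : ℝ => Real.exp (-(w / 2) * x ^ 2)) (2 * s * a * σ / w),
    integral_gaussian, show Real.pi / (w / 2) = 2 * Real.pi / w by field_simp,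
    Real.sqrt_div (by positivity)]
  have : √(2 * Real.pi) ≠ 0 := by positivity
  field_simp

/-- A unit-length combination of independent standard Gaussian variables is standard Gaussian. -/
theorem map_dotProduct_pi_gaussianReal {k : ℕ} (u : EuclideanSpace ℝ (Fin k)) (hu : ‖u‖ = 1) :
    (Measure.pi fun _ : Fin k => gaussianReal 0 1).map (fun x => x ⬝ᵥ u.ofLp) =
      gaussianReal 0 1 := by
  have h1 : (fun x : Fin k → ℝ => x ⬝ᵥ u.ofLp) = innerSL ℝ u ∘ WithLp.toLp 2 := by
    ext x
    simp [EuclideanSpace.inner_eq_star_dotProduct]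
  rw [h1, ← Measure.map_map (by fun_prop) (by fun_prop), map_pi_eq_stdGaussian,
    IsGaussian.map_eq_gaussianReal, variance_dual_stdGaussian, integral_strongDual_stdGaussian,
    innerSL_apply_norm, hu]
  simp

theorem integral_exp_mul_norm_sq_gaussianMatrix {d k : ℕ} (b : Fin d → ℝ) {σ s : ℝ}
    (hs : 2 * s * σ ^ 2 < 1) (u : EuclideanSpace ℝ (Fin k)) (hu : ‖u‖ = 1) :
    ∫ E, Real.exp (s * ∑ i, (b i + σ * (E *ᵥ u.ofLp) i) ^ 2) ∂(gaussianMatrix d k) =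
      (√(1 - 2 * s * σ ^ 2))⁻¹ ^ d *
        Real.exp (s * (∑ i, b i ^ 2) / (1 - 2 * s * σ ^ 2)) := by
  have h1 : ∀ E : Matrix (Fin d) (Fin k) ℝ,
      Real.exp (s * ∑ i, (b i + σ * (E *ᵥ u.ofLp) i) ^ 2) =
        ∏ i, Real.exp (s * (b i + σ * (E i ⬝ᵥ u.ofLp)) ^ 2) := fun E => by
    rw [Finset.mul_sum, Real.exp_sum]
    rfl
  simp_rw [h1]
  refine (integral_fintype_prod_eq_prod (𝕜 := ℝ) (ι := Fin d) (E := fun _ => Fin k → ℝ)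
    (fun i x => Real.exp (s * (b i + σ * (x ⬝ᵥ u.ofLp)) ^ 2))
    (μ := fun _ => Measure.pi fun _ : Fin k => gaussianReal 0 1)).trans ?_
  have h2 : ∀ i : Fin d, ∫ x : Fin k → ℝ, Real.exp (s * (b i + σ * (x ⬝ᵥ u.ofLp)) ^ 2)
      ∂(Measure.pi fun _ : Fin k => gaussianReal 0 1) =
      (√(1 - 2 * s * σ ^ 2))⁻¹ * Real.exp (s * b i ^ 2 / (1 - 2 * s * σ ^ 2)) := fun i => by
    have hm : Measurable fun x : Fin k → ℝ => x ⬝ᵥ u.ofLp := by unfold dotProduct; fun_prop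
    have h3 := integral_exp_mul_sq_gaussianReal (b i) σ s hs
    rwa [← map_dotProduct_pi_gaussianReal u hu, integral_map hm.aemeasurable (by fun_prop)] at h3
  simp_rw [h2]
  rw [Finset.prod_mul_distrib, Finset.prod_const, ← Real.exp_sum, Finset.card_univ,
    Fintype.card_fin, Finset.mul_sum, Finset.sum_div]

theorem measurable_norm_toEuclideanLin {d k : ℕ} (u : EuclideanSpace ℝ (Fin k)) :
    Measurable fun M : Matrix (Fin d) (Fin k) ℝ => ‖Matrix.toEuclideanLin M u‖ := by
  have : ∀ M : Matrix (Fin d) (Fin k) ℝ, ‖Matrix.toEuclideanLin M u‖ =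
      √(∑ i, (∑ j, M i j * u j) ^ 2) := fun M => by
    rw [EuclideanSpace.norm_eq]
    simp [Matrix.toLpLin_apply, Matrix.mulVec, dotProduct]
  simp_rw [this]
  refine Measurable.sqrt (Finset.measurable_sum _ fun i _ => Measurable.pow_const
    (Finset.measurable_sum _ fun j _ => Measurable.mul_const ?_ _) _)
  exact (measurable_pi_apply j).comp (measurable_pi_apply i)

theorem norm_orthogonal_mul_toEuclideanLin {d k : ℕ} (Q : Matrix.orthogonalGroup (Fin d) ℝ)
    (X : Matrix (Fin d) (Fin k) ℝ) (u : EuclideanSpace ℝ (Fin k)) :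
    ‖Matrix.toEuclideanLin ((Q : Matrix (Fin d) (Fin d) ℝ) * X) u‖ ^ 2 =
      ‖Matrix.toEuclideanLin X u‖ ^ 2 := by
  have hQ : (Q : Matrix (Fin d) (Fin d) ℝ)ᵀ * (Q : Matrix (Fin d) (Fin d) ℝ) = 1 := by
    simpa [Matrix.star_eq_conjTranspose] using Matrix.UnitaryGroup.star_mul_self Q
  rw [norm_toEuclideanLin_sq, norm_toEuclideanLin_sq, Matrix.transpose_mul, Matrix.mul_assoc,
    ← Matrix.mul_assoc _ _ X, hQ, Matrix.one_mul]

/-- Conditionally on the rotation, `‖Y u‖²` is a noncentral chi-squared variable whose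
noncentrality `‖X u‖²` does not depend on the rotation. -/
theorem integral_exp_mul_norm_sq_observationLaw {d k : ℕ}
    (ν : Measure (Matrix.orthogonalGroup (Fin d) ℝ)) [IsProbabilityMeasure ν]
    (X : Matrix (Fin d) (Fin k) ℝ) {σ s : ℝ} (hs : 2 * s * σ ^ 2 < 1)
    (u : EuclideanSpace ℝ (Fin k)) (hu : ‖u‖ = 1) :
    ∫ M, Real.exp (s * ‖Matrix.toEuclideanLin M u‖ ^ 2) ∂(observationLaw ν X σ) =
      (√(1 - 2 * s * σ ^ 2))⁻¹ ^ d *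
        Real.exp (s * ‖Matrix.toEuclideanLin X u‖ ^ 2 / (1 - 2 * s * σ ^ 2)) := by
  set K := (√(1 - 2 * s * σ ^ 2))⁻¹ ^ d *
        Real.exp (s * ‖Matrix.toEuclideanLin X u‖ ^ 2 / (1 - 2 * s * σ ^ 2)) with hK
  have hK0 : 0 < K := by
    have : 0 < 1 - 2 * s * σ ^ 2 := by linarith
    positivity
  have hmeas : Measurable fun M : Matrix (Fin d) (Fin k) ℝ =>
      Real.exp (s * ‖Matrix.toEuclideanLin M u‖ ^ 2) :=
    Real.measurable_exp.comp (((measurable_norm_toEuclideanLin u).pow_const 2).const_mul s)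
  have hfib : ∀ Q : Matrix.orthogonalGroup (Fin d) ℝ,
      ∫ E, Real.exp (s * ‖Matrix.toEuclideanLin
        ((Q : Matrix (Fin d) (Fin d) ℝ) * X + σ • E) u‖ ^ 2) ∂(gaussianMatrix d k) = K := fun Q => by
    rw [hK, ← norm_orthogonal_mul_toEuclideanLin Q X u]
    have h := integral_exp_mul_norm_sq_gaussianMatrix
      (((Q : Matrix (Fin d) (Fin d) ℝ) * X) *ᵥ u.ofLp) hs u hu
    simp only [EuclideanSpace.norm_sq_eq, Matrix.toLpLin_apply, Real.norm_eq_abs, sq_abs,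
      Matrix.add_mulVec, Matrix.smul_mulVec, Pi.add_apply, Pi.smul_apply, smul_eq_mul]
    exact h
  rw [observationLaw, integral_map (measurable_observation X σ).aemeasurable
    hmeas.aestronglyMeasurable]
  rw [integral_eq_lintegral_of_nonneg_ae (ae_of_all _ fun _ => (Real.exp_pos _).le)
    (hmeas.comp (measurable_observation X σ)).aestronglyMeasurable]
  have hprod := lintegral_prod (μ := ν) (ν := gaussianMatrix d k) _
    (ENNReal.measurable_ofReal.comp (hmeas.comp (measurable_observation X σ))).aemeasurable
  simp only [Function.comp_apply] at hprod
  rw [hprod]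
  have hin : ∀ Q : Matrix.orthogonalGroup (Fin d) ℝ,
      ∫⁻ E, ENNReal.ofReal (Real.exp (s * ‖Matrix.toEuclideanLin
        ((Q : Matrix (Fin d) (Fin d) ℝ) * X + σ • E) u‖ ^ 2)) ∂(gaussianMatrix d k) =
      ENNReal.ofReal K := fun Q => by
    rw [← hfib Q, ofReal_integral_eq_lintegral_ofReal]
    · -- the integral is nonzero, so the integrand is integrable
      by_contra hni
      exact hK0.ne ((integral_undef hni).symm.trans (hfib Q))
    · exact ae_of_all _ fun _ => (Real.exp_pos _).le
  simp_rw [hin]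
  rw [lintegral_const, measure_univ, mul_one, ENNReal.toReal_ofReal hK0.le]

/-! ### Bernstein-type moment bound -/

/-- For `z ≥ 0` this is `t ≤ sinh t` at `t = -log (1 - z)`. -/
theorem neg_log_one_sub_le {z : ℝ} (hz : |z| < 1) :
    -Real.log (1 - z) - z ≤ z ^ 2 / (2 * (1 - |z|)) := by
  rcases le_total 0 z with h | h
  · rw [abs_of_nonneg h] at hz ⊢
    have hw : 0 < 1 - z := by linarith
    have hlog : 0 ≤ Real.log (1 - z)⁻¹ := Real.log_nonneg ((one_le_inv₀ hw).mpr (by linarith))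
    have h1 := Real.self_le_sinh_iff.mpr hlog
    rw [Real.sinh_log (inv_pos.mpr hw), Real.log_inv, inv_inv] at h1
    have h2 : ((1 - z)⁻¹ - (1 - z)) / 2 = z + z ^ 2 / (2 * (1 - z)) := by
      field_simp; ring
    linarith
  · have h1 := Real.le_log_one_add_of_nonneg (neg_nonneg.mpr h)
    have h2 : -z - z ^ 2 / 2 ≤ 2 * -z / (-z + 2) := by
      rw [le_div_iff₀ (by linarith)]
      nlinarith [mul_nonneg (neg_nonneg.mpr h) (sq_nonneg z)]
    rw [← sub_eq_add_neg] at h1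
    have h3 : z ^ 2 / 2 ≤ z ^ 2 / (2 * (1 - |z|)) := by
      apply div_le_div_of_nonneg_left (sq_nonneg z)
      · linarith
      · linarith [abs_nonneg z]
    linarith

theorem mgf_norm_sq_observationLaw_le {d k : ℕ}
    (ν : Measure (Matrix.orthogonalGroup (Fin d) ℝ)) [IsProbabilityMeasure ν]
    (X : Matrix (Fin d) (Fin k) ℝ) {σ s : ℝ} (hs : 2 * σ ^ 2 * |s| < 1)
    (u : EuclideanSpace ℝ (Fin k)) (hu : ‖u‖ = 1) :
    0 < mgf (fun M => ‖Matrix.toEuclideanLin M u‖ ^ 2 -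
        (‖Matrix.toEuclideanLin X u‖ ^ 2 + d * σ ^ 2)) (observationLaw ν X σ) s ∧
    mgf (fun M => ‖Matrix.toEuclideanLin M u‖ ^ 2 -
        (‖Matrix.toEuclideanLin X u‖ ^ 2 + d * σ ^ 2)) (observationLaw ν X σ) s ≤
      Real.exp (s ^ 2 * ((2 * ‖Matrix.toEuclideanLin X u‖ ^ 2 + d * σ ^ 2) * σ ^ 2) /
        (1 - 2 * σ ^ 2 * |s|)) := by
  set A := ‖Matrix.toEuclideanLin X u‖ ^ 2 with hA
  have hA0 : 0 ≤ A := sq_nonneg _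
  set z := 2 * s * σ ^ 2 with hz
  have hzabs : |z| = 2 * σ ^ 2 * |s| := by
    rw [hz, abs_mul, abs_mul, abs_of_nonneg (sq_nonneg σ)]; norm_num; ring
  have hz1 : |z| < 1 := by rwa [hzabs]
  have hw0 : 0 < 1 - z := by linarith [le_abs_self z]
  have heq : mgf (fun M => ‖Matrix.toEuclideanLin M u‖ ^ 2 - (A + d * σ ^ 2))
      (observationLaw ν X σ) s =
      Real.exp (s * A / (1 - z) - s * A + d / 2 * (-Real.log (1 - z) - z)) := by
    have h1 : ∀ M : Matrix (Fin d) (Fin k) ℝ,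
        Real.exp (s * (‖Matrix.toEuclideanLin M u‖ ^ 2 - (A + d * σ ^ 2))) =
          Real.exp (s * ‖Matrix.toEuclideanLin M u‖ ^ 2) * Real.exp (-s * (A + d * σ ^ 2)) :=
      fun M => by rw [← Real.exp_add]; ring_nf
    simp only [mgf, h1]
    rw [integral_mul_const, integral_exp_mul_norm_sq_observationLaw ν X (by linarith) u hu]
    have h2 : (√(1 - z))⁻¹ = Real.exp (-(Real.log (1 - z) / 2)) := by
      rw [Real.exp_neg, ← Real.log_sqrt hw0.le, Real.exp_log (Real.sqrt_pos.mpr hw0)]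
    rw [h2, ← Real.exp_nat_mul, ← Real.exp_add, ← Real.exp_add]
    congr 1
    rw [hz]; ring
  rw [heq]
  refine ⟨Real.exp_pos _, Real.exp_le_exp.mpr ?_⟩
  have h1 := mul_le_mul_of_nonneg_left (neg_log_one_sub_le hz1) (by positivity : (0 : ℝ) ≤ d / 2)
  have h2 : s * A / (1 - z) - s * A = 2 * s ^ 2 * σ ^ 2 * A / (1 - z) := by
    field_simp; rw [hz]; ring
  have h3 : 2 * s ^ 2 * σ ^ 2 * A / (1 - z) ≤ 2 * s ^ 2 * σ ^ 2 * A / (1 - |z|) :=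
    div_le_div_of_nonneg_left (by positivity) (by linarith) (by linarith [le_abs_self z])
  rw [← hzabs]
  have h4 : s ^ 2 * ((2 * A + d * σ ^ 2) * σ ^ 2) / (1 - |z|) =
      2 * s ^ 2 * σ ^ 2 * A / (1 - |z|) + d / 2 * (z ^ 2 / (2 * (1 - |z|))) := by
    have : 1 - |z| ≠ 0 := by linarith
    field_simp
    rw [hz]; ring
  linarith

/-! ### Concentration of the Gram estimator -/

/-- Two-sided Bernstein inequality for a sum of independent variables with sub-gamma tails. -/
theorem measureReal_le_abs_sum_le {Ω : Type*} [MeasurableSpace Ω] {μ : Measure Ω}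
    [IsProbabilityMeasure μ] {N : ℕ} (hN : 0 < N) {W : Fin N → Ω → ℝ} (hind : iIndepFun W μ)
    (hm : ∀ i, AEMeasurable (W i) μ) {V c x : ℝ} (hV : 0 < V) (hc : 0 ≤ c) (hx : 0 < x)
    (hmgf : ∀ i s, c * |s| < 1 →
      0 < mgf (W i) μ s ∧ mgf (W i) μ s ≤ Real.exp (s ^ 2 * V / (1 - c * |s|))) :
    μ.real {ω | 2 * √(N * V * x) + c * x ≤ |∑ i, W i ω|} ≤ 2 * Real.exp (-x) := by
  set a := √(N * V) with ha
  set b := √x with hb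
  have hNV : 0 < (N : ℝ) * V := by positivity
  have ha0 : 0 < a := Real.sqrt_pos.mpr hNV
  have hb0 : 0 < b := Real.sqrt_pos.mpr hx
  have ha2 : a ^ 2 = N * V := Real.sq_sqrt hNV.le
  have hb2 : b ^ 2 = x := Real.sq_sqrt hx.le
  have hab : √(N * V * x) = a * b := Real.sqrt_mul hNV.le x
  -- the Chernoff exponent is minimized at `b / (a + c b)`
  have hD : 0 < a + c * b := by positivity
  set s := b / (a + c * b) with hs
  have hs0 : 0 < s := by positivity
  have hcs : 1 - c * s = a / (a + c * b) := by rw [hs]; field_simp; ring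
  have hcs0 : 0 < 1 - c * s := by rw [hcs]; positivity
  set y := 2 * √(N * V * x) + c * x with hy
  have hopt : -s * y + N * (s ^ 2 * V / (1 - c * s)) = -x := by
    have : (N : ℝ) * (s ^ 2 * V / (1 - c * s)) = a ^ 2 * s ^ 2 / (1 - c * s) := by
      rw [ha2]; ring
    rw [this, hcs, hy, hab, ← hb2, hs]
    field_simp
    ring
  have hsum : ∀ r, |r| = s → Integrable (fun ω => Real.exp (r * (∑ i, W i) ω)) μ ∧
      mgf (∑ i, W i) μ r ≤ Real.exp (N * (s ^ 2 * V / (1 - c * s))) := fun r hr => by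
    have h1 : ∀ i, 0 < mgf (W i) μ r ∧ mgf (W i) μ r ≤ Real.exp (s ^ 2 * V / (1 - c * s)) :=
      fun i => by
        have := hmgf i r (by rw [hr]; linarith)
        rwa [← sq_abs r, hr] at this
    have h2 := hind.mgf_sum₀ hm Finset.univ (t := r)
    constructor
    · rw [← mgf_pos_iff, h2]
      exact Finset.prod_pos fun i _ => (h1 i).1
    · rw [h2, Real.exp_nat_mul]
      refine (Finset.prod_le_prod (fun i _ => (h1 i).1.le) fun i _ => (h1 i).2).trans_eq ?_
      simp
  obtain ⟨hi1, hm1⟩ := hsum s (abs_of_pos hs0)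
  obtain ⟨hi2, hm2⟩ := hsum (-s) (by rw [abs_neg, abs_of_pos hs0])
  have hup : μ.real {ω | y ≤ (∑ i, W i) ω} ≤ Real.exp (-x) := by
    refine (measure_ge_le_exp_mul_mgf y hs0.le hi1).trans ?_
    rw [← hopt, Real.exp_add]
    exact mul_le_mul_of_nonneg_left hm1 (Real.exp_pos _).le
  have hlow : μ.real {ω | (∑ i, W i) ω ≤ -y} ≤ Real.exp (-x) := by
    refine (measure_le_le_exp_mul_mgf (-y) (neg_nonpos.mpr hs0.le) hi2).trans ?_
    rw [← hopt, Real.exp_add, show - -s * -y = -s * y by ring]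
    exact mul_le_mul_of_nonneg_left hm2 (Real.exp_pos _).le
  have hsub : {ω | y ≤ |∑ i, W i ω|} ⊆
      {ω | y ≤ (∑ i, W i) ω} ∪ {ω | (∑ i, W i) ω ≤ -y} := fun ω hω => by
    simp only [Set.mem_ofPred_eq, Set.mem_union, Finset.sum_apply] at hω ⊢
    rcases le_abs.mp hω with h | h
    · exact Or.inl h
    · exact Or.inr (by linarith)
  calc _ ≤ _ := measureReal_mono hsub
    _ ≤ _ := measureReal_union_le _ _
    _ ≤ _ := by linarith

theorem norm_toEuclideanLin_le_opNorm {m n : ℕ} (A : Matrix (Fin m) (Fin n) ℝ)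
    (u : EuclideanSpace ℝ (Fin n)) : ‖Matrix.toEuclideanLin A u‖ ≤ opNorm A * ‖u‖ :=
  (Matrix.toEuclideanLin A).toContinuousLinearMap.le_opNorm u

theorem quadForm_gramEstimator_sub {d k N : ℕ} (hN : 0 < N) (σ : ℝ)
    (Y : Fin N → Matrix (Fin d) (Fin k) ℝ) (X : Matrix (Fin d) (Fin k) ℝ)
    (u : EuclideanSpace ℝ (Fin k)) (hu : ‖u‖ = 1) :
    quadForm (gramEstimator σ Y - Xᵀ * X) u =
      (∑ i, (‖Matrix.toEuclideanLin (Y i) u‖ ^ 2 -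
        (‖Matrix.toEuclideanLin X u‖ ^ 2 + d * σ ^ 2))) / N := by
  have h1 : ∀ A : Matrix (Fin k) (Fin k) ℝ, ∀ a : ℝ, quadForm (a • A) u = a * quadForm A u :=
    fun A a => by simp [quadForm, real_inner_smul_right]
  have h2 : quadForm (1 : Matrix (Fin k) (Fin k) ℝ) u = 1 := by
    simp [quadForm, hu]
  have h3 : quadForm (∑ i, (Y i)ᵀ * Y i) u = ∑ i, ‖Matrix.toEuclideanLin (Y i) u‖ ^ 2 := by
    simp_rw [← quadForm_transpose_mul_self]
    simp only [quadForm, map_sum, LinearMap.sum_apply, inner_sum]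
  rw [quadForm_sub, gramEstimator, quadForm_sub, h1, h1, h2, h3, quadForm_transpose_mul_self,
    Finset.sum_sub_distrib, Finset.sum_const, Finset.card_univ, Fintype.card_fin, nsmul_eq_mul]
  have : (N : ℝ) ≠ 0 := by positivity
  field_simp
  ring

/-- The bracket `√((2‖X‖² + dσ²) (σ²/N) k log(10/δ)) + (σ²/N) k log(10/δ)` of the error bound. -/
noncomputable def noiseLevel {d k : ℕ} (X : Matrix (Fin d) (Fin k) ℝ) (σ δ : ℝ) (N : ℕ) : ℝ :=
  √((2 * opNorm X ^ 2 + d * σ ^ 2) * (σ ^ 2 / N) * k * Real.log (10 / δ)) +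
    σ ^ 2 / N * k * Real.log (10 / δ)

/-- Without noise the Gram matrix of every observation equals that of `X`. -/
theorem ae_quadForm_eq_zero_of_noiseless {d k N : ℕ} {Ω : Type*} [MeasurableSpace Ω]
    {μ : Measure Ω} {ν : Measure (Matrix.orthogonalGroup (Fin d) ℝ)}
    {X : Matrix (Fin d) (Fin k) ℝ} {Y : Fin N → Ω → Matrix (Fin d) (Fin k) ℝ} (hN : 0 < N)
    (hY : IsIIDSample μ ν X 0 Y)
    (u : EuclideanSpace ℝ (Fin k)) (hu : ‖u‖ = 1) :
    ∀ᵐ ω ∂μ, quadForm (gramEstimator 0 (fun i => Y i ω) - Xᵀ * X) u = 0 := by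
  have h : ∀ i, ∀ᵐ ω ∂μ, ‖Matrix.toEuclideanLin (Y i ω) u‖ ^ 2 =
      ‖Matrix.toEuclideanLin X u‖ ^ 2 := fun i => by
    have hset : MeasurableSet {M : Matrix (Fin d) (Fin k) ℝ | ‖Matrix.toEuclideanLin M u‖ ^ 2 =
        ‖Matrix.toEuclideanLin X u‖ ^ 2} :=
      measurableSet_eq_fun ((measurable_norm_toEuclideanLin u).pow_const 2) measurable_const
    have h1 : ∀ᵐ M ∂(observationLaw ν X 0), ‖Matrix.toEuclideanLin M u‖ ^ 2 =
        ‖Matrix.toEuclideanLin X u‖ ^ 2 := by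
      rw [observationLaw, ae_map_iff (measurable_observation X 0).aemeasurable hset]
      refine ae_of_all _ fun p => ?_
      rw [zero_smul, add_zero]
      exact norm_orthogonal_mul_toEuclideanLin p.1 X u
    rw [← (hY.law i).map_eq] at h1
    exact ae_of_ae_map (hY.law i).aemeasurable h1
  filter_upwards [ae_all_iff.mpr h] with ω hω
  rw [quadForm_gramEstimator_sub hN 0 _ X u hu]
  simp [hω]

section Sample

variable {d k N : ℕ} {Ω : Type*} [MeasurableSpace Ω] {μ : Measure Ω} [IsProbabilityMeasure μ]
  {ν : Measure (Matrix.orthogonalGroup (Fin d) ℝ)} [IsProbabilityMeasure ν]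
  {X : Matrix (Fin d) (Fin k) ℝ} {σ : ℝ} {Y : Fin N → Ω → Matrix (Fin d) (Fin k) ℝ}

theorem measureReal_quadForm_le_of_pos (hd : 0 < d) (hN : 0 < N) (hσ : 0 < σ)
    (hY : IsIIDSample μ ν X σ Y) (u : EuclideanSpace ℝ (Fin k)) (hu : ‖u‖ = 1) {x : ℝ}
    (hx : 0 < x) :
    μ.real {ω | 2 * (√((2 * opNorm X ^ 2 + d * σ ^ 2) * (σ ^ 2 / N) * x) + σ ^ 2 / N * x) ≤
      |quadForm (gramEstimator σ (fun i => Y i ω) - Xᵀ * X) u|} ≤ 2 * Real.exp (-x) := by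
  set f : Matrix (Fin d) (Fin k) ℝ → ℝ := fun M => ‖Matrix.toEuclideanLin M u‖ ^ 2 -
    (‖Matrix.toEuclideanLin X u‖ ^ 2 + d * σ ^ 2) with hf
  have hfm : Measurable f := ((measurable_norm_toEuclideanLin u).pow_const 2).sub_const _
  set V := (2 * opNorm X ^ 2 + d * σ ^ 2) * σ ^ 2 with hV
  have hdR : (0 : ℝ) < d := by exact_mod_cast hd
  have hNR : (0 : ℝ) < N := by exact_mod_cast hN
  have hV0 : 0 < V := by positivity
  have hXu : ‖Matrix.toEuclideanLin X u‖ ^ 2 ≤ opNorm X ^ 2 := by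
    have := norm_toEuclideanLin_le_opNorm X u
    rw [hu, mul_one] at this
    exact pow_le_pow_left₀ (norm_nonneg _) this 2
  have h := measureReal_le_abs_sum_le hN (W := fun i => f ∘ Y i) (V := V) (c := 2 * σ ^ 2)
    (hY.indep.comp (fun _ => f) fun _ => hfm)
    (fun i => hfm.comp_aemeasurable (hY.law i).aemeasurable) hV0 (by positivity) hx
    fun i s hs => by
      have h1 := mgf_norm_sq_observationLaw_le ν X hs u hu
      rw [← (hY.law i).map_eq, mgf_map (hY.law i).aemeasurable
        (Real.measurable_exp.comp (hfm.const_mul s)).aestronglyMeasurable] at h1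
      refine ⟨h1.1, h1.2.trans (Real.exp_le_exp.mpr ?_)⟩
      have : 0 < 1 - 2 * σ ^ 2 * |s| := by linarith
      rw [hV]
      gcongr
  refine (measureReal_mono fun ω hω => ?_).trans h
  simp only [Set.mem_ofPred_eq] at hω ⊢
  rw [quadForm_gramEstimator_sub hN σ _ X u hu, abs_div, abs_of_pos hNR, le_div_iff₀ hNR] at hω
  refine le_trans (le_of_eq ?_) hω
  have h2 : √(N * V * x) = N * √((2 * opNorm X ^ 2 + d * σ ^ 2) * (σ ^ 2 / N) * x) := by
    rw [← Real.sqrt_sq hNR.le, ← Real.sqrt_mul (sq_nonneg _), Real.sqrt_sq hNR.le]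
    congr 1
    rw [hV]
    field_simp
  rw [h2]
  field_simp

/-- The Chernoff bound `measureReal_quadForm_le_of_pos` needs a positive variance proxy; for
`σ = 0` the deviation vanishes almost surely. -/
theorem measureReal_quadForm_le (hd : 0 < d) (hN : 0 < N) (hσ : 0 ≤ σ)
    (hY : IsIIDSample μ ν X σ Y) (u : EuclideanSpace ℝ (Fin k)) (hu : ‖u‖ = 1) {x : ℝ}
    (hx : 0 < x) :
    μ.real {ω | 2 * (√((2 * opNorm X ^ 2 + d * σ ^ 2) * (σ ^ 2 / N) * x) + σ ^ 2 / N * x) <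
      |quadForm (gramEstimator σ (fun i => Y i ω) - Xᵀ * X) u|} ≤ 2 * Real.exp (-x) := by
  rcases hσ.eq_or_lt with rfl | hσ
  · have h0 := ae_quadForm_eq_zero_of_noiseless hN hY u hu
    have : μ.real {ω | 2 * (√((2 * opNorm X ^ 2 + d * (0 : ℝ) ^ 2) * ((0 : ℝ) ^ 2 / N) * x) +
        (0 : ℝ) ^ 2 / N * x) <
        |quadForm (gramEstimator 0 (fun i => Y i ω) - Xᵀ * X) u|} = 0 := by
      rw [measureReal_eq_zero_iff]
      refine measure_mono_null (fun ω hω => ?_) (ae_iff.mp h0)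
      simp only [Set.mem_ofPred_eq] at hω ⊢
      intro h
      rw [h] at hω
      simp at hω
    rw [this]
    positivity
  · refine (measureReal_mono fun ω hω => ?_).trans
      (measureReal_quadForm_le_of_pos hd hN hσ hY u hu hx)
    simp only [Set.mem_ofPred_eq] at hω ⊢
    exact hω.le

/-- Uniform concentration of the quadratic form of the Gram estimator, by a union bound over a
symmetric net of at most `9 ^ k / 2` points, each failing with probability at most
`2 (δ / 10) ^ k`. -/
theorem exists_event_quadForm_le (hd : 0 < d) (hk : 0 < k) (hN : 0 < N) (hσ : 0 ≤ σ) {δ : ℝ}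
    (hδ : δ ∈ Set.Ioo (0 : ℝ) 1) (hY : IsIIDSample μ ν X σ Y) :
    ∃ A : Set Ω, MeasurableSet A ∧ ENNReal.ofReal (1 - δ) ≤ μ A ∧ ∀ ω ∈ A,
      ∀ u, |quadForm (gramEstimator σ (fun i => Y i ω) - Xᵀ * X) u| ≤
        4 * noiseLevel X σ δ N * ‖u‖ ^ 2 := by
  obtain ⟨hδ0, hδ1⟩ := hδ
  obtain ⟨T, hT1, hTcard, hTnet⟩ := exists_symmetric_net (EuclideanSpace ℝ (Fin k))
  rw [finrank_euclideanSpace_fin] at hTcard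
  set x := k * Real.log (10 / δ) with hx
  have hlog : 0 < Real.log (10 / δ) := Real.log_pos (by rw [lt_div_iff₀ hδ0]; linarith)
  have hx0 : 0 < x := by positivity
  set bad : EuclideanSpace ℝ (Fin k) → Set Ω := fun u =>
    {ω | 2 * noiseLevel X σ δ N < |quadForm (gramEstimator σ (fun i => Y i ω) - Xᵀ * X) u|}
    with hbad
  have hexp : Real.exp (-x) = (δ / 10) ^ k := by
    rw [hx, ← mul_neg, ← Real.log_inv, inv_div, Real.exp_nat_mul, Real.exp_log (by positivity)]
  have hbadle : ∀ u ∈ T, μ.real (bad u) ≤ 2 * (δ / 10) ^ k := fun u hu => by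
    have := measureReal_quadForm_le hd hN hσ hY u (hT1 u hu) hx0
    rw [hexp, hx, ← mul_assoc, ← mul_assoc] at this
    exact this
  set B := ⋃ u ∈ T, bad u with hB
  have hBle : μ.real B ≤ δ := calc
    μ.real B ≤ ∑ u ∈ T, μ.real (bad u) := measureReal_biUnion_finset_le _ _
    _ ≤ T.card * (2 * (δ / 10) ^ k) := by
      rw [← nsmul_eq_mul]; exact Finset.sum_le_card_nsmul _ _ _ hbadle
    _ = (2 * T.card : ℕ) * (δ / 10) ^ k := by push_cast; ring
    _ ≤ 9 ^ k * (δ / 10) ^ k := by gcongr; exact_mod_cast hTcard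
    _ = (9 * (δ / 10)) ^ k := (mul_pow _ _ _).symm
    _ ≤ (9 * (δ / 10)) ^ 1 := pow_le_pow_of_le_one (by positivity) (by linarith) hk
    _ ≤ δ := by linarith
  -- the sample is only almost everywhere measurable, so `B` need not be a measurable set
  refine ⟨(toMeasurable μ B)ᶜ, (measurableSet_toMeasurable μ B).compl, ?_, fun ω hω u => ?_⟩
  · rw [prob_compl_eq_one_sub (measurableSet_toMeasurable μ B), measure_toMeasurable,
      ENNReal.ofReal_sub _ hδ0.le, ENNReal.ofReal_one]
    refine tsub_le_tsub_left ?_ 1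
    rw [← ofReal_measureReal (measure_ne_top μ B)]
    exact ENNReal.ofReal_le_ofReal hBle
  · have hωB : ω ∉ B := fun h => hω (subset_toMeasurable μ B h)
    have hm : ∀ c ∈ T, |quadForm (gramEstimator σ (fun i => Y i ω) - Xᵀ * X) c| ≤
        2 * noiseLevel X σ δ N := fun c hc => by
      by_contra! hcon
      exact hωB (Set.mem_biUnion hc hcon)
    have := abs_quadForm_le_of_net hT1 hTnet hm u
    linarith

end Sample

theorem errorBound_eq {d k : ℕ} (L : ℝ) (X : Matrix (Fin d) (Fin k) ℝ) (σ δ : ℝ) (N : ℕ) :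
    errorBound L X σ δ N = L / singularValue X d * (√(2 * d) * (2 * (4 * noiseLevel X σ δ N))) := by
  rw [errorBound, noiseLevel]
  ring

theorem tendsto_errorBound {d k : ℕ} (L : ℝ) (X : Matrix (Fin d) (Fin k) ℝ) (σ δ : ℝ) :
    Filter.Tendsto (errorBound L X σ δ) Filter.atTop (nhds 0) := by
  have h1 : Filter.Tendsto (fun N : ℕ => σ ^ 2 / (N : ℝ)) Filter.atTop (nhds 0) :=
    tendsto_const_div_atTop_nhds_zero_nat _
  have h2 : Continuous fun t : ℝ => 8 * L * √(2 * d) / singularValue X d *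
      (√((2 * opNorm X ^ 2 + d * σ ^ 2) * t * k * Real.log (10 / δ)) +
        t * k * Real.log (10 / δ)) := by fun_prop
  have h3 := (h2.tendsto 0).comp h1
  simp only [zero_mul, mul_zero, Real.sqrt_zero, add_zero] at h3
  exact h3

theorem noiseLevel_nonneg {d k : ℕ} (X : Matrix (Fin d) (Fin k) ℝ) (σ : ℝ) {δ : ℝ}
    (hδ : δ ∈ Set.Ioo (0 : ℝ) 1) (N : ℕ) : 0 ≤ noiseLevel X σ δ N := by
  have : 0 ≤ Real.log (10 / δ) :=
    Real.log_nonneg (by rw [le_div_iff₀ hδ.1]; linarith [hδ.2])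
  unfold noiseLevel
  positivity

end CloudEstimation

theorem mainTheorem3 (d k : ℕ) (hd : 0 < d) (X : Matrix (Fin d) (Fin k) ℝ) (hX : X.rank = d)
    (σ : ℝ) (hσ : 0 ≤ σ) (δ : ℝ) (hδ : δ ∈ Set.Ioo (0 : ℝ) 1) :
    (∀ (N : ℕ), 1 ≤ N →
      ∀ (ν : Measure (Matrix.orthogonalGroup (Fin d) ℝ)) [IsProbabilityMeasure ν]
        (Ω : Type*) [MeasurableSpace Ω] (μ : Measure Ω) [IsProbabilityMeasure μ]
        (Y : Fin N → Ω → Matrix (Fin d) (Fin k) ℝ), CloudEstimation.IsIIDSample μ ν X σ Y →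
        ∃ A : Set Ω, MeasurableSet A ∧ ENNReal.ofReal (1 - δ) ≤ μ A ∧
          ∀ ω ∈ A, ∀ x, CloudEstimation.IsAlgorithmOutput σ (fun i => Y i ω) x →
            CloudEstimation.rho (CloudEstimation.cloudClass X) x ≤
              CloudEstimation.errorBound (1 / √(2 * (√2 - 1))) X σ δ N) ∧
    (∀ L : ℝ, 1 / √2 < L → ∃ N₀ : ℕ, ∀ N : ℕ, 1 ≤ N → N₀ ≤ N →
      ∀ (ν : Measure (Matrix.orthogonalGroup (Fin d) ℝ)) [IsProbabilityMeasure ν]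
        (Ω : Type*) [MeasurableSpace Ω] (μ : Measure Ω) [IsProbabilityMeasure μ]
        (Y : Fin N → Ω → Matrix (Fin d) (Fin k) ℝ), CloudEstimation.IsIIDSample μ ν X σ Y →
        ∃ A : Set Ω, MeasurableSet A ∧ ENNReal.ofReal (1 - δ) ≤ μ A ∧
          ∀ ω ∈ A, ∀ x, CloudEstimation.IsAlgorithmOutput σ (fun i => Y i ω) x →
            CloudEstimation.rho (CloudEstimation.cloudClass X) x ≤
              CloudEstimation.errorBound L X σ δ N) := by
  open CloudEstimation in
  have hdk : d ≤ k := hX ▸ X.rank_le_width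
  have hs0 := singularValue_pos hd hX
  have hs := posSemidef_mul_transpose_sub_singularValue hd hX
  have hL0 : 0 < 1 / √(2 * (√2 - 1)) := by
    have : 1 < √2 := by rw [Real.lt_sqrt] <;> norm_num
    have : 0 < 2 * (√2 - 1) := by linarith
    positivity
  refine ⟨fun N hN ν _ Ω _ μ _ Y hY => ?_, fun L hL => ?_⟩
  · obtain ⟨A, hA, hμA, hA'⟩ := exists_event_quadForm_le hd (hd.trans_le hdk) hN hσ hδ hY
    refine ⟨A, hA, hμA, fun ω hω x hx => ?_⟩
    obtain ⟨eig, v, heig, hv, rfl⟩ := hx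
    have hF := frobNorm_gramFactor_sub_le hdk heig hv
      (mul_nonneg zero_le_four (noiseLevel_nonneg X σ hδ N)) (hA' ω hω)
    rw [errorBound_eq]
    exact (rho_le_of_posSemidef hs0 hs _).trans
      (mul_le_mul_of_nonneg_left hF (div_pos hL0 hs0).le)
  · have hLpos : 0 < L := lt_trans (by positivity) hL
    have hgap : 0 < singularValue X d * (√2 - 1 / L) := by
      have : 1 / L < √2 := by
        rw [div_lt_iff₀ (by positivity)] at hL
        rw [div_lt_iff₀ hLpos]
        linarith
      exact mul_pos hs0 (by linarith)
    obtain ⟨N₀, hN₀⟩ := Filter.eventually_atTop.mp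
      ((tendsto_errorBound (1 / √(2 * (√2 - 1))) X σ δ).eventually (eventually_le_nhds hgap))
    refine ⟨N₀, fun N hN hNN ν _ Ω _ μ _ Y hY => ?_⟩
    obtain ⟨A, hA, hμA, hA'⟩ := exists_event_quadForm_le hd (hd.trans_le hdk) hN hσ hδ hY
    refine ⟨A, hA, hμA, fun ω hω x hx => ?_⟩
    obtain ⟨eig, v, heig, hv, rfl⟩ := hx
    have hF := frobNorm_gramFactor_sub_le hdk heig hv
      (mul_nonneg zero_le_four (noiseLevel_nonneg X σ hδ N)) (hA' ω hω)
    have hsmall := hN₀ N hNN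
    rw [errorBound_eq] at hsmall ⊢
    exact (rho_le_of_posSemidef_of_le hs0 hs _ hLpos
      ((mul_le_mul_of_nonneg_left hF (div_pos hL0 hs0).le).trans hsmall)).trans
      (mul_le_mul_of_nonneg_left hF (div_pos hLpos hs0).le)
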